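/- **Setting.** Let $d\ge 1$, $\Omega=(0,2\pi)^d$, $\phi_k(x)=(2\pi)^{-d/2}e^{ik\cdot x}$ and $c_k=\sqrt{1+|k|^2}$ for $k\in\mathbb Z^d$ ($|\cdot|$ is the Euclidean norm). Identify $v=\sum_k\hat v_k\phi_k\in V=H^1_p(\Omega)$ with $(\hat V_k)=(c_k\hat v_k)\in\ell^2(\mathbb Z^d)$ and $f\in H^{-1}_p(\Omega)$ with $(\hat F_k)=(c_k^{-1}\langle f,\phi_k\rangle)\in\ell^2(\mathbb Z^d)$; $\|\cdot\|$ denotes the $\ell^2$ norm of these coefficients, and $P_\Lambda$ the restriction of the coefficients to $\Lambda\subset\mathbb Z^d$. Let $\nu,\sigma$ be real (measurable) coefficients with $0<\nu_*\le\nu\le\nu^*$, $0<\sigma_*\le\sigma\le\sigma^*$ on $\Omega$, $\alpha_*=\min(\nu_*,\sigma_*)$, $\alpha^*=\max(\nu^*,\sigma^*)$, $a(v,w)=\int_\Omega\nu\nabla v\cdot\nabla\bar w+\int_\Omega\sigma v\bar w$, and let $u\in V$ solve $a(u,v)=\langle f,v\rangle$ for all $v\in V$. For finite $\Lambda\subset\mathbb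 Z^d$ let $u_\Lambda\in V_\Lambda=\mathrm{span}\{\phi_k:k\in\Lambda\}$ be the Galerkin solution, and let $r(w)=f-Lw$ be the residual, i.e. $\langle r(w),\phi_k\rangle=\langle f,\phi_k\rangle-a(w,\phi_k)$. Let $\mathbf A=(a_{\ell,k})$, $a_{\ell,k}=a(\phi_k,\phi_\ell)/(c_\ell c_k)$, be the stiffness matrix. A matrix $\mathbf B$ belongs to $\mathcal D_a(\eta_L)$ (resp. $\mathcal D_e(\eta_L)$) if $|b_{\ell,k}|\le c\,(1+|\ell-k|)^{-\eta_L}$ (resp. $\le c\,e^{-\eta_L|\ell-k|}$) for some constant $c>0$ and all $\ell,k$; $\mathbf B_J$ is $\mathbf B$ with the entries with $|\ell-k|>J$ replaced by $0$. **Sparsity classes.** $\omega_d$ is the volume of the Euclidean unit ball of $\mathbb R^d$, $E_N(v)=\inf_{|\Lambda|=N}\|v-P_\Lambda v\|$, and, for $\eta>0$ and $t\in(0,d]$, $\mathcal A_G^{\eta,t}$ is the set of all $v$ (functions in $V$, or forms in $V'$) with $\|v\|_{\mathcal A_G^{\eta,t}}=\sup_{N\ge 0}E_N(v)\exp(\eta\,\omega_d^{-t/d}N^{t/d})<\infty$.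 **Algorithm PC-ADFOUR$(\theta,tol,J)$**, $\theta\in(0,1)$, $tol\in[0,1)$. Let $\psi$ be a truncation bound $\|\mathbf A^{-1}-(\mathbf A^{-1})_J\|\le\psi(J)$ for all integers $J\ge 0$, where either $\psi(J)=c(J+1)^{-(\eta_L-d)}$ with $\mathbf A\in\mathcal D_a(\eta_L)$, $\eta_L>d$, or $\psi(J)=c(J+1)^{d-1}e^{-\bar\eta_LJ}$ with $\mathbf A\in\mathcal D_e(\eta_L)$, $0<\bar\eta_L\le\eta_L$ (and $c$ is a constant). $J$ is the smallest integer $J\ge 1$ with $\psi(J)\le\sqrt{(1-\theta^2)/(\alpha_*\alpha^*)}$. Start with $\Lambda_0=\emptyset$, $u_0=0$, $r_0=f$. For $n=0,1,\dots$: choose a finite set $S_n$ of minimal cardinality with $\|P_{S_n}r_n\|\ge\theta\|r_n\|$; put $\widehat\Lambda_{n+1}=\Lambda_n\cup\{k:|k-\ell|\le J\text{ for some }\ell\in S_n\}$ and $\hat u_{n+1}=u_{\widehat\Lambda_{n+1}}$; choose $\Lambda_{n+1}\subseteq\widehat\Lambda_{n+1}$ of minimal cardinality with $\|\hat u_{n+1}-P_{\Lambda_{n+1}}\hat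 u_{n+1}\|\le\frac{2}{\alpha_*}\sqrt{1-\theta^2}\,\|r_n\|$; put $u_{n+1}=u_{\Lambda_{n+1}}$, $r_{n+1}=r(u_{n+1})$; repeat while $\|r_{n+1}\|>tol$. **Theorem (cardinality of PC-ADFOUR).** Suppose that $u\in\mathcal A_G^{\eta,t}$ for some $\eta>0$ and $t\in(0,d]$. (1) For every $\kappa>1$ there is a constant $C>1$, depending only on $\kappa$, $d$, $\nu,\sigma$ (with their bounds), $\eta$ and $t$, such that for every set $\Lambda_n$, $n\ge 0$, produced by PC-ADFOUR, $$|\Lambda_n|\le\kappa\,\frac{\omega_d}{\eta^{d/t}}\Big(\log\frac{\|u\|_{\mathcal A_G^{\eta,t}}}{\|u-u_n\|}+\log C\Big)^{d/t}.$$ (2) Let in addition $d\le 10$, $\mathbf A\in\mathcal D_e(\eta_L)$ and $\mathbf A^{-1}\in\mathcal D_e(\bar\eta_L)$ with $0<\bar\eta_L\le\eta_L$, and $\eta<\omega_d^{t/(d(1+2t))}\,\bar\eta_L$. Then there are $\bar\eta\in(0,\eta]$ and $\bar t\in(0,t]$, not depending on $u$, with the property $(\ast)$ there is a constant $K$ such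 that, for every solution $u\in\mathcal A_G^{\eta,t}$ (with any right-hand side) and every finite $\Lambda$, $r(u_\Lambda)\in\mathcal A_G^{\bar\eta,\bar t}$ and $\|r(u_\Lambda)\|_{\mathcal A_G^{\bar\eta,\bar t}}\le K\|u\|_{\mathcal A_G^{\eta,t}}$; and there is a constant $\kappa>1$ depending only on $d$ such that, for all $\bar\eta\in(0,\eta]$ and $\bar t\in(0,t]$ with property $(\ast)$, there is a constant $C>1$, depending only on $d$, $\nu,\sigma$ (with their bounds), $\eta,t,\bar\eta,\bar t$, such that for every predictor set $\widehat\Lambda_{n+1}$, $n\ge 0$, produced by PC-ADFOUR, $$|\widehat\Lambda_{n+1}|\le|\Lambda_n|+\kappa J^d\frac{\omega_d^2}{\bar\eta^{d/\bar t}}\Big(\log\frac{\|u\|_{\mathcal A_G^{\eta,t}}}{\|u-u_n\|}+\big|\log\sqrt{1-\theta^2}\,\big|+\log C\Big)^{d/\bar t}.$$ In both bounds the quantities in parentheses are nonnegative; if $u_n=u$ the right-hand sides are read as $+\infty$ and nothing is claimed. -/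

import Mathlib

open MeasureTheory Filter Topology
open scoped ENNReal ComplexConjugate

noncomputable section

namespace PCAdfour

/-! ### The trigonometric basis and periodic Sobolev spaces -/

/-- Multi-indices `k ∈ ℤ^d`. -/
abbrev Idx (d : ℕ) : Type := Fin d → ℤ

/-- Complex families indexed by `ℤ^d`. -/
abbrev Coeff (d : ℕ) : Type := Idx d → ℂ

/-- The Euclidean length `|k|` of a multi-index. -/
def len {d : ℕ} (k : Idx d) : ℝ := Real.sqrt (∑ j, (k j : ℝ) ^ 2)

/-- The normalization factor `c_k = (1 + |k|²)^{1/2}`. -/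
def wt {d : ℕ} (k : Idx d) : ℝ := Real.sqrt (1 + len k ^ 2)

/-- The periodicity cell `Ω = (0, 2π)^d`. -/
def cell (d : ℕ) : Set (Fin d → ℝ) := Set.univ.pi fun _ => Set.Ioo 0 (2 * Real.pi)

/-- Lebesgue measure on the periodicity cell. -/
abbrev cellMeasure (d : ℕ) : Measure (Fin d → ℝ) := volume.restrict (cell d)

/-- The trigonometric basis function `φ_k(x) = (2π)^{-d/2} exp(i k·x)`. -/
def trig {d : ℕ} (k : Idx d) (x : Fin d → ℝ) : ℂ :=
  (((2 * Real.pi) ^ (-(d : ℝ) / 2) : ℝ) : ℂ) *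
    Complex.exp (Complex.I * ((∑ j, (k j : ℝ) * x j : ℝ) : ℂ))

instance isFiniteMeasure_cellMeasure (d : ℕ) : IsFiniteMeasure (cellMeasure d) := by
  refine ⟨?_⟩
  rw [Measure.restrict_apply_univ, cell, Real.volume_pi_Ioo]
  exact ENNReal.prod_lt_top fun _ _ => ENNReal.ofReal_lt_top

theorem memLp_trig {d : ℕ} (k : Idx d) : MemLp (trig k) 2 (cellMeasure d) := by
  have hc : Continuous (trig k) := by
    unfold trig
    fun_prop
  refine MemLp.of_bound hc.aestronglyMeasurable ((2 * Real.pi) ^ (-(d : ℝ) / 2)) ?_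
  refine Eventually.of_forall fun x => ?_
  have h0 : (0 : ℝ) ≤ (2 * Real.pi) ^ (-(d : ℝ) / 2) := by positivity
  rw [trig, norm_mul, mul_comm Complex.I, Complex.norm_exp_ofReal_mul_I, mul_one,
    Complex.norm_real, Real.norm_of_nonneg h0]

/-- The element `∑ b_k φ_k` of `L²(Ω)`, for a square-summable family `b`. -/
def synth {d : ℕ} (b : Coeff d) : Lp ℂ 2 (cellMeasure d) :=
  ∑' k, b k • (memLp_trig k).toLp (trig k)

/-- Square-summable families.  An element `v = ∑ v̂_k φ_k` of `V = H¹_p(Ω)` is identified with the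
family `V̂_k = c_k v̂_k` of its `H¹_p`-normalized Fourier coefficients, an element `f` of the dual
space `H⁻¹_p(Ω)` with the family `F̂_k = ⟨f, φ_k⟩ / c_k` of its `H⁻¹_p`-normalized coefficients.
By Parseval and Riesz-Fischer, both spaces thereby are the space of all square-summable
families. -/
def MemV {d : ℕ} (v : Coeff d) : Prop := Memℓp v 2

/-- The norm `(∑ |V̂_k|²)^{1/2}`: the norm of `H¹_p(Ω)` for normalized coefficients of a function,
that of `H⁻¹_p(Ω)` for normalized coefficients of a form. -/
def nrm {d : ℕ} (v : Coeff d) : ℝ := Real.sqrt (∑' k, ‖v k‖ ^ 2)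

/-- The function `v = ∑ v̂_k φ_k`, `v̂_k = V̂_k / c_k`, with normalized coefficients `V̂`. -/
def func {d : ℕ} (v : Coeff d) : Lp ℂ 2 (cellMeasure d) :=
  synth fun k => v k / (wt k : ℂ)

/-- The partial derivative `∂_j v = ∑ i k_j v̂_k φ_k` of that function. -/
def pderiv {d : ℕ} (v : Coeff d) (j : Fin d) : Lp ℂ 2 (cellMeasure d) :=
  synth fun k => Complex.I * (k j : ℂ) * (v k / (wt k : ℂ))

/-- The normalized coefficients of `φ_k / c_k`. -/
def unitVec {d : ℕ} (k : Idx d) : Coeff d := Pi.single k 1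

/-- The projection `P_Λ`. -/
def proj {d : ℕ} (Λ : Finset (Idx d)) (v : Coeff d) : Coeff d := fun k => if k ∈ Λ then v k else 0

/-- Membership in `V_Λ = span {φ_k : k ∈ Λ}`. -/
def MemSpan {d : ℕ} (Λ : Finset (Idx d)) (v : Coeff d) : Prop := ∀ k, k ∉ Λ → v k = 0

/-- The (antilinear in `v`) duality `⟨f, v⟩`. -/
def pairing {d : ℕ} (F v : Coeff d) : ℂ := ∑' k, F k * conj (v k)

/-! ### The elliptic problem and its stiffness matrix -/

/-- The coefficients of `L u = -∇·(ν ∇u) + σ u`, with their bounds on `Ω`. -/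
structure EllipticData (d : ℕ) where
  ν : (Fin d → ℝ) → ℝ
  σ : (Fin d → ℝ) → ℝ
  measurable_ν : Measurable ν
  measurable_σ : Measurable σ
  νlo : ℝ
  νhi : ℝ
  σlo : ℝ
  σhi : ℝ
  νlo_pos : 0 < νlo
  σlo_pos : 0 < σlo
  ν_bounds : ∀ x ∈ cell d, νlo ≤ ν x ∧ ν x ≤ νhi
  σ_bounds : ∀ x ∈ cell d, σlo ≤ σ x ∧ σ x ≤ σhi

/-- `α_* = min(ν_*, σ_*)`. -/
def EllipticData.αlo {d : ℕ} (D : EllipticData d) : ℝ := min D.νlo D.σlo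

/-- `α^* = max(ν^*, σ^*)`. -/
def EllipticData.αhi {d : ℕ} (D : EllipticData d) : ℝ := max D.νhi D.σhi

/-- The form `a(v, w) = ∫_Ω ν ∇v·∇w̄ + ∫_Ω σ v w̄`. -/
def form {d : ℕ} (D : EllipticData d) (v w : Coeff d) : ℂ :=
  (∫ x, (D.ν x : ℂ) * ∑ j, pderiv v j x * conj (pderiv w j x) ∂(cellMeasure d)) +
    ∫ x, (D.σ x : ℂ) * (func v x * conj (func w x)) ∂(cellMeasure d)

/-- `u ∈ H¹_p(Ω)` is the variational solution of `L u = f`. -/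
def IsSolution {d : ℕ} (D : EllipticData d) (F u : Coeff d) : Prop :=
  MemV u ∧ ∀ v, MemV v → form D u v = pairing F v

/-- `w` is the Galerkin solution in `V_Λ`. -/
def IsGalerkin {d : ℕ} (D : EllipticData d) (F : Coeff d) (Λ : Finset (Idx d)) (w : Coeff d) :
    Prop :=
  MemSpan Λ w ∧ ∀ v, MemSpan Λ v → form D w v = pairing F v

/-- The normalized coefficients `R̂_k = c_k⁻¹ (⟨f, φ_k⟩ - a(w, φ_k))` of `r(w) = f - L w`. -/
def residual {d : ℕ} (D : EllipticData d) (F w : Coeff d) : Coeff d :=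
  fun k => F k - form D w (unitVec k)

/-- The stiffness matrix `a_{ℓ,k} = a(φ_k, φ_ℓ) / (c_ℓ c_k)`. -/
def stiffness {d : ℕ} (D : EllipticData d) (l k : Idx d) : ℂ := form D (unitVec k) (unitVec l)

/-- `B` is the matrix of the inverse on `ℓ²(ℤ^d)` of the stiffness operator: its `k`-th column is
the solution whose normalized right-hand side is the `k`-th unit vector. -/
def IsInverseStiffness {d : ℕ} (D : EllipticData d) (B : Idx d → Idx d → ℂ) : Prop :=
  ∀ k, IsSolution D (unitVec k) fun l => B l k

/-- The algebraic class `𝒟_a(η)` of matrices. -/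
def AlgMatrix {d : ℕ} (η : ℝ) (B : Idx d → Idx d → ℂ) : Prop :=
  ∃ c : ℝ, 0 < c ∧ ∀ l k, ‖B l k‖ ≤ c * (1 + len (l - k)) ^ (-η)

/-- The exponential class `𝒟_e(η)` of matrices. -/
def ExpMatrix {d : ℕ} (η : ℝ) (B : Idx d → Idx d → ℂ) : Prop :=
  ∃ c : ℝ, 0 < c ∧ ∀ l k, ‖B l k‖ ≤ c * Real.exp (-η * len (l - k))

/-- The truncation `B_J` of a matrix. -/
def trunc {d : ℕ} (B : Idx d → Idx d → ℂ) (J : ℕ) (l k : Idx d) : ℂ :=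
  open Classical in if len (l - k) ≤ J then B l k else 0

/-- The operator norm on `ℓ²(ℤ^d)` of the matrix `B` is at most `M`
(tested on finitely supported vectors). -/
def MatNormLE {d : ℕ} (B : Idx d → Idx d → ℂ) (M : ℝ) : Prop :=
  ∀ x y : Idx d →₀ ℂ,
    ‖∑ l ∈ y.support, ∑ k ∈ x.support, conj (y l) * B l k * x k‖ ≤ M * nrm x * nrm y

/-- `ψ` is a truncation bound for the inverse stiffness matrix `B`, i.e. `‖B - B_J‖ ≤ ψ(J)` for all
`J ≥ 0`, of the form going with the algebraic or with the exponential class. -/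
def IsTruncBound {d : ℕ} (D : EllipticData d) (B : Idx d → Idx d → ℂ) (ψ : ℕ → ℝ) : Prop :=
  ((∃ ηL c : ℝ, (d : ℝ) < ηL ∧ AlgMatrix ηL (stiffness D) ∧
        ∀ J : ℕ, ψ J = c * ((J : ℝ) + 1) ^ (-(ηL - d))) ∨
    (∃ ηL ηLbar c : ℝ, 0 < ηLbar ∧ ηLbar ≤ ηL ∧ ExpMatrix ηL (stiffness D) ∧
        ∀ J : ℕ, ψ J = c * ((J : ℝ) + 1) ^ ((d : ℝ) - 1) * Real.exp (-ηLbar * J))) ∧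
  ∀ J : ℕ, MatNormLE (fun l k => B l k - trunc B J l k) (ψ J)

/-- `J` is the smallest integer `J ≥ 1` with `ψ(J) ≤ ((1 - θ²) / (α_* α^*))^{1/2}`, for a truncation
bound `ψ` of the inverse stiffness matrix. -/
def IsEnrichRadius {d : ℕ} (D : EllipticData d) (θ : ℝ) (J : ℕ) : Prop :=
  ∃ (B : Idx d → Idx d → ℂ) (ψ : ℕ → ℝ), IsInverseStiffness D B ∧ IsTruncBound D B ψ ∧
    IsLeast {m : ℕ | 1 ≤ m ∧ ψ m ≤ Real.sqrt ((1 - θ ^ 2) / (D.αlo * D.αhi))} J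

/-! ### The algorithm -/

/-- `S` is an output of DÖRFLER`(r, θ)`: a set of minimal cardinality with `‖P_S r‖ ≥ θ ‖r‖`. -/
def IsDorfler {d : ℕ} (r : Coeff d) (θ : ℝ) (S : Finset (Idx d)) : Prop :=
  θ * nrm r ≤ nrm (proj S r) ∧
    ∀ S' : Finset (Idx d), θ * nrm r ≤ nrm (proj S' r) → S.card ≤ S'.card

/-- `E` is the output of ENRICH`(S, J)`. -/
def IsEnrich {d : ℕ} (S : Finset (Idx d)) (J : ℕ) (E : Finset (Idx d)) : Prop :=
  ∀ k, k ∈ E ↔ ∃ l ∈ S, len (k - l) ≤ J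

/-- `Λ` is an output of COARSE`(w, ε)`, where `w ∈ V_{Λ'}`: a subset of `Λ'` of minimal cardinality
with `‖w - P_Λ w‖ ≤ 2 ε`. -/
def IsCoarse {d : ℕ} (Λ' : Finset (Idx d)) (w : Coeff d) (ε : ℝ) (Λ : Finset (Idx d)) : Prop :=
  Λ ⊆ Λ' ∧ nrm (w - proj Λ w) ≤ 2 * ε ∧
    ∀ S ⊆ Λ', nrm (w - proj S w) ≤ 2 * ε → Λ.card ≤ S.card

/-- A complete run of PC-ADFOUR`(θ, tol, J)`, with `N ∈ {1, 2, …, ∞}` passages through the loop.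
`Λ n`, `u n` are the active sets and Galerkin solutions, `Λhat (n+1)`, `uhat (n+1)` those of the
predictor step of the passage number `n`.  The values at indices beyond the run are irrelevant. -/
structure IsPCRun {d : ℕ} (D : EllipticData d) (F : Coeff d) (θ tol : ℝ) (J : ℕ) (N : ℕ∞)
    (Λ Λhat : ℕ → Finset (Idx d)) (u uhat : ℕ → Coeff d) : Prop where
  init_set : Λ 0 = ∅
  init_sol : u 0 = 0
  one_le : 1 ≤ N
  predictor : ∀ n : ℕ, (n : ℕ∞) < N → ∃ S E : Finset (Idx d),
    IsDorfler (residual D F (u n)) θ S ∧ IsEnrich S J E ∧ Λhat (n + 1) = Λ n ∪ E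
  predictor_sol : ∀ n : ℕ, (n : ℕ∞) < N → IsGalerkin D F (Λhat (n + 1)) (uhat (n + 1))
  corrector : ∀ n : ℕ, (n : ℕ∞) < N → IsCoarse (Λhat (n + 1)) (uhat (n + 1))
    (1 / D.αlo * Real.sqrt (1 - θ ^ 2) * nrm (residual D F (u n))) (Λ (n + 1))
  corrector_sol : ∀ n : ℕ, (n : ℕ∞) < N → IsGalerkin D F (Λ (n + 1)) (u (n + 1))
  continue_loop : ∀ n : ℕ, 1 ≤ n → (n : ℕ∞) < N → tol < nrm (residual D F (u n))
  exit_loop : ∀ n : ℕ, (n : ℕ∞) = N → nrm (residual D F (u n)) ≤ tol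

/-! ### Exponential sparsity classes -/

/-- The measure `ω_d` of the Euclidean unit ball of `ℝ^d`. -/
def ballVol (d : ℕ) : ℝ := (volume (Metric.ball (0 : EuclideanSpace ℝ (Fin d)) 1)).toReal

/-- The best `N`-term approximation error `E_N(v)`. -/
def bestErr {d : ℕ} (v : Coeff d) (N : ℕ) : ℝ :=
  ⨅ Λ : {Λ : Finset (Idx d) // Λ.card = N}, nrm (v - proj Λ.1 v)

/-- The quantity `E_N(v) exp(η ω_d^{-t/d} N^{t/d})`. -/
def expRatio {d : ℕ} (η t : ℝ) (v : Coeff d) (N : ℕ) : ℝ :=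
  bestErr v N * Real.exp (η * ballVol d ^ (-(t / d)) * (N : ℝ) ^ (t / d))

/-- Membership in the class `𝒜_G^{η,t}` (of functions, or of forms). -/
def MemExpClass {d : ℕ} (η t : ℝ) (v : Coeff d) : Prop :=
  MemV v ∧ BddAbove (Set.range (expRatio η t v))

/-- The quantity `‖v‖` in `𝒜_G^{η,t}`. -/
def expNorm {d : ℕ} (η t : ℝ) (v : Coeff d) : ℝ := ⨆ N : ℕ, expRatio η t v N

/-- `ηbar ≤ η` and `tbar ≤ t` are positive numbers such that, for solutions `u ∈ 𝒜_G^{η,t}`, the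
residuals of all Galerkin solutions belong to `𝒜_G^{ηbar,tbar}`, with norms bounded by a constant
multiple of the norm of `u`. -/
def ResidualSparsity {d : ℕ} (D : EllipticData d) (η t ηbar tbar : ℝ) : Prop :=
  0 < ηbar ∧ ηbar ≤ η ∧ 0 < tbar ∧ tbar ≤ t ∧
    ∃ K : ℝ, ∀ F u : Coeff d, MemV F → IsSolution D F u → MemExpClass η t u →
      ∀ (Λ : Finset (Idx d)) (w : Coeff d), IsGalerkin D F Λ w →
        MemExpClass ηbar tbar (residual D F w) ∧
          expNorm ηbar tbar (residual D F w) ≤ K * expNorm η t u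

end PCAdfour

end

noncomputable section

namespace PCAdfour

/-! ### The sequence space and its weighted shifts -/

/-! In normalized coefficients the problem reads `A u = F` on ℓ²(ℤ^d), with `A = opA D` self-adjoint
and α_* ≤ A ≤ α^*. Galerkin solutions are best approximations in the energy norm, hence
quasi-optimal in ℓ² with factor α^*/α_*. Write ε = (1/α_*) √(1-θ²) ‖r_n‖, so that coarsening has
tolerance 2ε.

The key to (1) is a strict gap (`exists_predictor_factor`): the predictor error is at most qε with q
< 2 depending only on the data. The competitor is u_n plus the truncation of A⁻¹ P_S r_n. The
triangle inequality in the energy norm would give exactly 2; bounding the cross term by ‖A a‖ ‖b‖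
instead gives q = √(2 + 2√(α_*/α^*)), which is below 2 unless α_* = α^*, and in that case A is a
multiple of the identity and q = 1. Owing to the gap, every Y with ‖u - P_Y u‖ ≤ (2-q)ε is
admissible for the coarsening, so |Λ_{n+1}| is at most the number of terms needed to approximate u
up to (2-q)ε. Since also ‖u - u_{n+1}‖ ≤ (α^*/α_*)(q+2)ε, that tolerance is comparable with the new
error, and the definition of the sparsity class gives the logarithmic bound. The rounding up of the
number of terms is absorbed by enlarging C, because x ↦ x^{d/t} is superadditive.

For (2), minimality in Dörfler marking bounds |S_n| by the number of terms approximating r_n up to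
√(1-θ²)‖r_n‖, which the sparsity of r_n controls; enrichment multiplies it by at most (2J+1)^d ≤
(3J)^d.

Sparsity of residuals, uniformly in Λ, comes from a banded Richardson iteration inside V_Λ
(`exists_banded_iterate`). Replace A by a banded T with error exponentially small in the bandwidth
J, and u by x = P_S u. Each step z ↦ z + ω P_Λ T(x - z) enlarges the support by J and contracts the
error to u_Λ, so n steps approximate u_Λ, and then the residual, by families supported near S. With
|S| = n^q and J ~ n the error is O(e^{-γn}) on O(n^{q+2d}) indices, which is membership in a class
with exponent d/(q+2d). -/

/-- The Hilbert space of square-summable families indexed by `ℤ^d`. -/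
abbrev Hil (d : ℕ) : Type := lp (fun _ : Idx d => ℂ) 2

theorem two_toReal_pos : 0 < (2 : ℝ≥0∞).toReal := by norm_num

theorem memV_iff_summable {d : ℕ} {v : Coeff d} : MemV v ↔ Summable fun k => ‖v k‖ ^ 2 := by
  rw [MemV, memℓp_gen_iff two_toReal_pos]
  norm_num

theorem memV_coe {d : ℕ} (v : Hil d) : MemV (v : Coeff d) := lp.memℓp v

theorem summable_sq {d : ℕ} (v : Hil d) : Summable fun k => ‖v k‖ ^ 2 :=
  memV_iff_summable.1 (memV_coe v)

theorem norm_sq_eq_tsum {d : ℕ} (v : Hil d) : ‖v‖ ^ 2 = ∑' k, ‖v k‖ ^ 2 := by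
  have h := lp.norm_rpow_eq_tsum two_toReal_pos v
  norm_num at h
  exact h

theorem nrm_coe {d : ℕ} (v : Hil d) : nrm (v : Coeff d) = ‖v‖ := by
  rw [nrm, ← norm_sq_eq_tsum, Real.sqrt_sq (norm_nonneg _)]

theorem exists_hil {d : ℕ} {v : Coeff d} (h : MemV v) : ∃ w : Hil d, (w : Coeff d) = v :=
  ⟨⟨v, h⟩, rfl⟩

theorem inner_eq_pairing {d : ℕ} (v F : Hil d) : inner ℂ v F = pairing (F : Coeff d) v := by
  rw [lp.inner_eq_tsum, pairing]
  rfl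

theorem memV_of_memSpan {d : ℕ} {Λ : Finset (Idx d)} {v : Coeff d} (h : MemSpan Λ v) : MemV v := by
  rw [memV_iff_summable]
  refine summable_of_ne_finset_zero (s := Λ) fun k hk => ?_
  simp [h k hk]

theorem memV_weighted_shift {d : ℕ} {a : Coeff d} {C : ℝ} (ha : ∀ k, ‖a k‖ ≤ C) (m : Idx d)
    (v : Hil d) : MemV fun k => a k * v (k - m) := by
  rw [memV_iff_summable]
  have h1 : Summable fun k => ‖v (k - m)‖ ^ 2 :=
    (Equiv.subRight m).summable_iff.2 (summable_sq v)
  refine Summable.of_nonneg_of_le (fun k => by positivity) (fun k => ?_) (h1.mul_left (C ^ 2))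
  rw [norm_mul, mul_pow]
  gcongr
  exact ha k

/-- The linear map `(v_k) ↦ (a_k v_{k-m})` for a bounded family `a`. -/
def wshiftLin {d : ℕ} (a : Coeff d) (C : ℝ) (ha : ∀ k, ‖a k‖ ≤ C) (m : Idx d) :
    Hil d →ₗ[ℂ] Hil d where
  toFun v := ⟨fun k => a k * v (k - m), memV_weighted_shift ha m v⟩
  map_add' v w := lp.ext <| funext fun k => mul_add (a k) (v (k - m)) (w (k - m))
  map_smul' c v := lp.ext <| funext fun k => mul_left_comm (a k) c (v (k - m))

theorem norm_wshiftLin_apply_le {d : ℕ} (a : Coeff d) (C : ℝ) (ha : ∀ k, ‖a k‖ ≤ C) (m : Idx d)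
    (v : Hil d) : ‖wshiftLin a C ha m v‖ ≤ C * ‖v‖ := by
  have hC : 0 ≤ C := (norm_nonneg _).trans (ha 0)
  have h1 : Summable fun k => ‖v (k - m)‖ ^ 2 :=
    (Equiv.subRight m).summable_iff.2 (summable_sq v)
  have h2 : ‖v‖ ^ 2 = ∑' k, ‖v (k - m)‖ ^ 2 := by
    rw [norm_sq_eq_tsum]
    exact ((Equiv.subRight m).tsum_eq fun k => ‖v k‖ ^ 2).symm
  refine abs_le_of_sq_le_sq' ?_ (by positivity) |>.2
  rw [norm_sq_eq_tsum, mul_pow, h2, ← tsum_mul_left]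
  refine Summable.tsum_le_tsum (fun k => ?_) (summable_sq _) (h1.mul_left _)
  have h3 : wshiftLin a C ha m v k = a k * v (k - m) := rfl
  rw [h3, norm_mul, mul_pow]
  gcongr
  exact ha k

/-- The operator `(v_k) ↦ (a_k v_{k-m})` for a bounded family `a`. -/
def wshift {d : ℕ} (a : Coeff d) (C : ℝ) (ha : ∀ k, ‖a k‖ ≤ C) (m : Idx d) : Hil d →L[ℂ] Hil d :=
  (wshiftLin a C ha m).mkContinuous C (norm_wshiftLin_apply_le a C ha m)

theorem wshift_apply {d : ℕ} (a : Coeff d) (C : ℝ) (ha : ∀ k, ‖a k‖ ≤ C) (m : Idx d) (v : Hil d)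
    (k : Idx d) : wshift a C ha m v k = a k * v (k - m) := rfl

theorem norm_wshift_le {d : ℕ} (a : Coeff d) (C : ℝ) (ha : ∀ k, ‖a k‖ ≤ C) (m : Idx d) :
    ‖wshift a C ha m‖ ≤ C :=
  LinearMap.mkContinuous_norm_le _ ((norm_nonneg _).trans (ha 0)) _

/-- Multiplication by a family bounded by one. -/
def diagOp {d : ℕ} (a : Coeff d) (ha : ∀ k, ‖a k‖ ≤ 1) : Hil d →L[ℂ] Hil d := wshift a 1 ha 0

theorem diagOp_apply {d : ℕ} (a : Coeff d) (ha : ∀ k, ‖a k‖ ≤ 1) (v : Hil d) (k : Idx d) :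
    diagOp a ha v k = a k * v k := by
  rw [diagOp, wshift_apply, sub_zero]

theorem norm_indicator_le {d : ℕ} (Λ : Finset (Idx d)) (k : Idx d) :
    ‖(if k ∈ Λ then 1 else 0 : ℂ)‖ ≤ 1 := by
  split_ifs <;> simp

/-- The projection `P_Λ` as an operator. -/
def projH {d : ℕ} (Λ : Finset (Idx d)) : Hil d →L[ℂ] Hil d :=
  diagOp (fun k => if k ∈ Λ then 1 else 0) (norm_indicator_le Λ)

theorem projH_apply {d : ℕ} (Λ : Finset (Idx d)) (v : Hil d) (k : Idx d) :
    projH Λ v k = if k ∈ Λ then v k else 0 := by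
  rw [projH, diagOp_apply]
  simp

theorem coe_projH {d : ℕ} (Λ : Finset (Idx d)) (v : Hil d) :
    (projH Λ v : Coeff d) = proj Λ v := funext fun k => projH_apply Λ v k

theorem memSpan_projH {d : ℕ} (Λ : Finset (Idx d)) (v : Hil d) : MemSpan Λ (projH Λ v) :=
  fun k hk => by rw [projH_apply, if_neg hk]

theorem projH_eq_self {d : ℕ} {Λ : Finset (Idx d)} {v : Hil d} (h : MemSpan Λ v) :
    projH Λ v = v := by
  ext k
  rw [projH_apply]
  split_ifs with hk
  · rfl
  · exact (h k hk).symm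

theorem nrm_proj {d : ℕ} (Λ : Finset (Idx d)) (v : Hil d) : nrm (proj Λ v) = ‖projH Λ v‖ := by
  rw [← coe_projH, nrm_coe]

theorem nrm_sub_proj {d : ℕ} (Λ : Finset (Idx d)) (v : Hil d) :
    nrm ((v : Coeff d) - proj Λ v) = ‖v - projH Λ v‖ := by
  rw [← coe_projH, ← lp.coeFn_sub, nrm_coe]

theorem nrm_sub_coe {d : ℕ} (v w : Hil d) : nrm ((v : Coeff d) - (w : Coeff d)) = ‖v - w‖ := by
  rw [← lp.coeFn_sub, nrm_coe]

theorem norm_projH_le {d : ℕ} (Λ : Finset (Idx d)) (v : Hil d) : ‖projH Λ v‖ ≤ ‖v‖ := by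
  simpa using (projH Λ).le_of_opNorm_le (norm_wshift_le _ 1 _ _) v

theorem inner_projH_left {d : ℕ} {Λ : Finset (Idx d)} {v : Hil d} (w : Hil d) (h : MemSpan Λ v) :
    inner ℂ v (projH Λ w) = inner ℂ v w := by
  rw [lp.inner_eq_tsum, lp.inner_eq_tsum]
  refine tsum_congr fun k => ?_
  rw [projH_apply]
  split_ifs with hk
  · rfl
  · rw [h k hk]; simp

theorem norm_sq_eq_projH_add {d : ℕ} (Λ : Finset (Idx d)) (v : Hil d) :
    ‖v‖ ^ 2 = ‖projH Λ v‖ ^ 2 + ‖v - projH Λ v‖ ^ 2 := by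
  have h : inner ℂ (projH Λ v) (v - projH Λ v) = 0 := by
    rw [inner_sub_right, inner_projH_left v (memSpan_projH Λ v), sub_self]
  have := norm_add_sq_eq_norm_sq_add_norm_sq_of_inner_eq_zero _ _ h
  rw [add_sub_cancel] at this
  simpa [sq] using this

theorem norm_sub_projH_le {d : ℕ} (Λ : Finset (Idx d)) (v : Hil d) : ‖v - projH Λ v‖ ≤ ‖v‖ := by
  refine abs_le_of_sq_le_sq' ?_ (norm_nonneg _) |>.2
  rw [norm_sq_eq_projH_add Λ v]
  nlinarith [sq_nonneg ‖projH Λ v‖]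

theorem norm_sub_projH_antitone {d : ℕ} {Λ Λ' : Finset (Idx d)} (h : Λ ⊆ Λ') (v : Hil d) :
    ‖v - projH Λ' v‖ ≤ ‖v - projH Λ v‖ := by
  have : v - projH Λ' v = (v - projH Λ v) - projH Λ' (v - projH Λ v) := by
    rw [map_sub, projH_eq_self (Λ := Λ') (v := projH Λ v) fun k hk => memSpan_projH Λ v k
      fun hk' => hk (h hk')]
    abel
  rw [this]
  exact norm_sub_projH_le _ _

/-- Passes from finite sections to the whole family; matrix norms are only tested on finitely
supported vectors. -/
theorem norm_le_of_forall_projH_le {d : ℕ} {v : Hil d} {C : ℝ} (hC : 0 ≤ C)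
    (h : ∀ Λ : Finset (Idx d), ‖projH Λ v‖ ≤ C) : ‖v‖ ≤ C := by
  refine lp.norm_le_of_forall_sum_le two_toReal_pos hC fun Λ => ?_
  have h1 : ∑ k ∈ Λ, ‖v k‖ ^ 2 = ‖projH Λ v‖ ^ 2 := by
    rw [norm_sq_eq_tsum, tsum_eq_sum (s := Λ)]
    · exact Finset.sum_congr rfl fun k hk => by rw [projH_apply, if_pos hk]
    · intro k hk
      rw [projH_apply, if_neg hk]; simp
  have h2 := pow_le_pow_left₀ (norm_nonneg _) (h Λ) 2
  norm_num
  linarith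

/-- The unit vectors of the sequence space. -/
def unitH {d : ℕ} (k : Idx d) : Hil d := lp.single 2 k (1 : ℂ)

theorem coe_unitH {d : ℕ} (k : Idx d) : (unitH k : Coeff d) = unitVec k := by
  rw [unitH, lp.coeFn_single, unitVec]

theorem inner_unitH_left {d : ℕ} (k : Idx d) (v : Hil d) : inner ℂ (unitH k) v = v k := by
  rw [unitH, lp.inner_single_left]
  simp

theorem norm_unitH {d : ℕ} (k : Idx d) : ‖unitH k‖ = 1 := by
  rw [unitH, lp.norm_single (by norm_num)]
  simp

/-! ### Best approximation -/

/-- For d = 0 there is a single index and no sets of cardinality N ≥ 2, so the infimum in `bestErr`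
would be over an empty family. Here d ≥ 1 enters best approximation: sets can be enlarged to any
prescribed cardinality. -/
theorem infinite_idx {d : ℕ} (hd : 1 ≤ d) : Infinite (Idx d) := by
  have : Nonempty (Fin d) := ⟨⟨0, hd⟩⟩
  exact Pi.infinite_of_right

theorem bddBelow_bestErr {d : ℕ} (v : Coeff d) (N : ℕ) :
    BddBelow (Set.range fun Λ : {Λ : Finset (Idx d) // Λ.card = N} => nrm (v - proj Λ.1 v)) :=
  ⟨0, by rintro _ ⟨Λ, rfl⟩; exact Real.sqrt_nonneg _⟩

theorem bestErr_nonneg {d : ℕ} (v : Coeff d) (N : ℕ) : 0 ≤ bestErr v N :=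
  Real.iInf_nonneg fun _ => Real.sqrt_nonneg _

theorem bestErr_le {d : ℕ} (hd : 1 ≤ d) (v : Hil d) {N : ℕ} {Λ : Finset (Idx d)}
    (h : Λ.card ≤ N) : bestErr (v : Coeff d) N ≤ ‖v - projH Λ v‖ := by
  have := infinite_idx hd
  obtain ⟨Λ', h1, h2⟩ := Infinite.exists_superset_card_eq Λ N h
  refine (ciInf_le (bddBelow_bestErr (v : Coeff d) N) ⟨Λ', h2⟩).trans ?_
  rw [nrm_sub_proj]
  exact norm_sub_projH_antitone h1 v

theorem bestErr_zero {d : ℕ} (v : Hil d) : bestErr (v : Coeff d) 0 = ‖v‖ := by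
  have h : ∀ Λ : {Λ : Finset (Idx d) // Λ.card = 0},
      nrm ((v : Coeff d) - proj Λ.1 v) = ‖v‖ := by
    rintro ⟨Λ, hΛ⟩
    rw [Finset.card_eq_zero] at hΛ
    subst hΛ
    have : proj (∅ : Finset (Idx d)) v = 0 := by
      funext k; simp [proj]
    rw [this, sub_zero, nrm_coe]
  have : Nonempty {Λ : Finset (Idx d) // Λ.card = 0} := ⟨⟨∅, rfl⟩⟩
  rw [bestErr, iInf_congr h, ciInf_const]

theorem exists_card_eq_norm_sub_lt {d : ℕ} (hd : 1 ≤ d) (v : Hil d) (N : ℕ) {ε : ℝ}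
    (h : bestErr (v : Coeff d) N < ε) :
    ∃ Λ : Finset (Idx d), Λ.card = N ∧ ‖v - projH Λ v‖ < ε := by
  have := infinite_idx hd
  obtain ⟨Λ₀, h₀⟩ := Infinite.exists_subset_card_eq (Idx d) N
  have : Nonempty {Λ : Finset (Idx d) // Λ.card = N} := ⟨⟨Λ₀, h₀⟩⟩
  obtain ⟨Λ, hΛ⟩ := exists_lt_of_ciInf_lt h
  refine ⟨Λ.1, Λ.2, ?_⟩
  rwa [nrm_sub_proj] at hΛ

theorem ballVol_pos (d : ℕ) : 0 < ballVol d :=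
  ENNReal.toReal_pos (Metric.measure_ball_pos _ _ one_pos).ne' measure_ball_lt_top.ne

theorem expRatio_le_expNorm {d : ℕ} {η t : ℝ} {v : Coeff d} (h : MemExpClass η t v) (N : ℕ) :
    expRatio η t v N ≤ expNorm η t v := le_ciSup h.2 N

theorem norm_le_expNorm {d : ℕ} (hd : 1 ≤ d) {η t : ℝ} (ht : 0 < t) {v : Hil d}
    (h : MemExpClass η t (v : Coeff d)) : ‖v‖ ≤ expNorm η t (v : Coeff d) := by
  have h1 := expRatio_le_expNorm h 0
  have hd' : (0 : ℝ) < d := by exact_mod_cast hd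
  rwa [expRatio, bestErr_zero, Nat.cast_zero, Real.zero_rpow (by positivity), mul_zero,
    Real.exp_zero, mul_one] at h1

/-- A member of an exponential class is approximated up to `ε` by few terms. -/
theorem exists_card_le_norm_sub_le {d : ℕ} (hd : 1 ≤ d) {η t : ℝ} (hη : 0 < η) (ht : 0 < t)
    {v : Hil d} (h : MemExpClass η t (v : Coeff d)) {ε X : ℝ} (hε : 0 < ε) (hX : 0 ≤ X)
    (hX' : Real.log (2 * expNorm η t (v : Coeff d) / ε) ≤ X) :
    ∃ Λ : Finset (Idx d), ‖v - projH Λ v‖ ≤ ε ∧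
      (Λ.card : ℝ) ≤ ballVol d / η ^ ((d : ℝ) / t) * X ^ ((d : ℝ) / t) + 1 := by
  have hd' : (0 : ℝ) < d := by exact_mod_cast hd
  have hω := ballVol_pos d
  set p := (d : ℝ) / t with hp
  have hp0 : 0 < p := by positivity
  -- Y solves η ω_d^{-t/d} Y^{t/d} = X; rounding up costs the `+ 1` of the statement.
  set Y := ballVol d / η ^ p * X ^ p with hY
  have hY0 : 0 ≤ Y := by positivity
  set N := ⌈Y⌉₊ with hN
  have hNY : Y ≤ N := Nat.le_ceil Y
  have hexp : X ≤ η * ballVol d ^ (-(t / d)) * (N : ℝ) ^ (t / d) := by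
    have h1 : Y ^ (t / d) ≤ (N : ℝ) ^ (t / d) := Real.rpow_le_rpow hY0 hNY (by positivity)
    have h2 : Y ^ (t / d) = ballVol d ^ (t / d) / η * X := by
      have hpt : p * (t / d) = 1 := by rw [hp]; field_simp
      rw [hY, Real.mul_rpow (by positivity) (by positivity), Real.div_rpow hω.le (by positivity),
        ← Real.rpow_mul hη.le, ← Real.rpow_mul hX, hpt, Real.rpow_one, Real.rpow_one]
    have h3 : X = η * ballVol d ^ (-(t / d)) * Y ^ (t / d) := by
      rw [h2, Real.rpow_neg hω.le]
      field_simp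
    rw [h3]
    gcongr
  -- The infimum defining `bestErr` need not be known to be attained. The factor 2 in the logarithm
  -- makes this inequality strict, which yields an actual set.
  have hE : bestErr (v : Coeff d) N < ε := by
    have h1 := expRatio_le_expNorm h N
    rw [expRatio] at h1
    have h0 := bestErr_nonneg (v : Coeff d) N
    rcases h0.eq_or_lt with h0 | h0
    · rwa [← h0]
    have hA : 0 < expNorm η t (v : Coeff d) := lt_of_lt_of_le (by positivity) h1
    have h2 : 2 * expNorm η t (v : Coeff d) / ε ≤ Real.exp X := by
      rw [← Real.log_le_iff_le_exp (by positivity)]; exact hX'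
    rw [div_le_iff₀ hε] at h2
    have h3 : bestErr (v : Coeff d) N * Real.exp X ≤ expNorm η t (v : Coeff d) :=
      le_trans (by gcongr) h1
    have h4 := Real.exp_pos X
    nlinarith
  obtain ⟨Λ, hc, hΛ⟩ := exists_card_eq_norm_sub_lt hd v N hE
  refine ⟨Λ, hΛ.le, ?_⟩
  rw [hc]
  exact (Nat.ceil_lt_add_one hY0).le

/-- Superadditivity of x ↦ x^p for p ≥ 1: a fixed shift of the logarithm pays for the `+ 1` coming
from rounding up. -/
theorem mul_rpow_add_one_le {a p X c : ℝ} (ha : 0 ≤ a) (hp : 1 ≤ p) (hX : 0 ≤ X) (hc : 0 ≤ c)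
    (h : 1 ≤ a * c ^ p) : a * X ^ p + 1 ≤ a * (X + c) ^ p := by
  have h1 : X ^ p + c ^ p ≤ (X + c) ^ p := by
    exact Real.add_rpow_le_rpow_add hX hc hp
  nlinarith

/-! ### Orthonormality of the trigonometric basis -/

theorem integral_exp_int_mul (n : ℤ) :
    ∫ x in Set.Ioo (0 : ℝ) (2 * Real.pi), Complex.exp (Complex.I * ((n : ℝ) * x : ℝ)) =
      if n = 0 then ((2 * Real.pi : ℝ) : ℂ) else 0 := by
  rw [← integral_Ioc_eq_integral_Ioo, ← intervalIntegral.integral_of_le (by positivity)]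
  split_ifs with hn
  · subst hn
    simp
  · have hc : Complex.I * (n : ℂ) ≠ 0 := mul_ne_zero Complex.I_ne_zero (by exact_mod_cast hn)
    have h1 := integral_exp_mul_complex (a := 0) (b := 2 * Real.pi) hc
    have h2 : Complex.exp (Complex.I * n * ((2 * Real.pi : ℝ) : ℂ)) = 1 := by
      rw [← Complex.exp_int_mul_two_pi_mul_I n]
      congr 1
      push_cast
      ring
    rw [h2] at h1
    simp only [Complex.ofReal_zero, mul_zero, Complex.exp_zero, sub_self, zero_div] at h1
    rw [← h1]
    congr 1
    funext x
    push_cast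
    ring_nf

theorem integral_cell_exp {d : ℕ} (m : Idx d) :
    ∫ x, Complex.exp (Complex.I * ((∑ j, (m j : ℝ) * x j : ℝ) : ℂ)) ∂(cellMeasure d) =
      if m = 0 then (((2 * Real.pi) ^ (d : ℝ) : ℝ) : ℂ) else 0 := by
  have h1 : ∀ x : Fin d → ℝ, Complex.exp (Complex.I * ((∑ j, (m j : ℝ) * x j : ℝ) : ℂ)) =
      ∏ j, Complex.exp (Complex.I * ((m j : ℝ) * x j : ℝ)) := by
    intro x
    rw [← Complex.exp_sum, Complex.ofReal_sum, Finset.mul_sum]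
  simp_rw [h1]
  rw [cellMeasure, cell, volume_pi, Measure.restrict_pi_pi,
    integral_fintype_prod_eq_prod
      (f := fun j (y : ℝ) => Complex.exp (Complex.I * ((m j : ℝ) * y : ℝ)))]
  simp_rw [integral_exp_int_mul]
  split_ifs with hm
  · subst hm
    simp
  · obtain ⟨j, hj⟩ := Function.ne_iff.1 hm
    exact Finset.prod_eq_zero (Finset.mem_univ j) (if_neg hj)

theorem conj_trig_mul_trig {d : ℕ} (k l : Idx d) (x : Fin d → ℝ) :
    trig l x * conj (trig k x) = (((2 * Real.pi) ^ (-(d : ℝ)) : ℝ) : ℂ) *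
      Complex.exp (Complex.I * ((∑ j, ((l - k) j : ℝ) * x j : ℝ) : ℂ)) := by
  have h2 : ((2 * Real.pi) ^ (-(d : ℝ)) : ℝ) =
      (2 * Real.pi) ^ (-(d : ℝ) / 2) * (2 * Real.pi) ^ (-(d : ℝ) / 2) := by
    rw [← Real.rpow_add (by positivity), add_halves]
  have h3 : (Complex.I * ((∑ j, ((l - k) j : ℝ) * x j : ℝ) : ℂ)) =
      Complex.I * ((∑ j, (l j : ℝ) * x j : ℝ) : ℂ) +
        -Complex.I * ((∑ j, (k j : ℝ) * x j : ℝ) : ℂ) := by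
    simp only [Pi.sub_apply, Int.cast_sub, sub_mul, Finset.sum_sub_distrib, Complex.ofReal_sub]
    ring
  rw [h2, h3, Complex.exp_add, trig, trig, map_mul, Complex.conj_ofReal, ← Complex.exp_conj,
    map_mul, Complex.conj_I, Complex.conj_ofReal, Complex.ofReal_mul]
  ring

theorem orthonormal_trig (d : ℕ) :
    Orthonormal ℂ fun k : Idx d => (memLp_trig k).toLp (trig k) := by
  rw [orthonormal_iff_ite]
  intro k l
  rw [L2.inner_def]
  have h1 : ∫ x, inner ℂ ((memLp_trig k).toLp (trig k) x) ((memLp_trig l).toLp (trig l) x)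
      ∂(cellMeasure d) = ∫ x, (((2 * Real.pi) ^ (-(d : ℝ)) : ℝ) : ℂ) *
      Complex.exp (Complex.I * ((∑ j, ((l - k) j : ℝ) * x j : ℝ) : ℂ)) ∂(cellMeasure d) := by
    refine integral_congr_ae ?_
    filter_upwards [(memLp_trig k).coeFn_toLp, (memLp_trig l).coeFn_toLp] with x h1 h2
    rw [h1, h2, ← conj_trig_mul_trig, RCLike.inner_apply]
  rw [h1, integral_const_mul, integral_cell_exp]
  have h2 : l - k = 0 ↔ k = l := by rw [sub_eq_zero, eq_comm]
  simp only [h2]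
  split_ifs
  · rw [← Complex.ofReal_mul, ← Real.rpow_add (by positivity)]
    simp
  · simp

/-- Synthesis as an isometry of the sequence space into `L²(Ω)`. -/
def synthH (d : ℕ) : Hil d →ₗᵢ[ℂ] Lp ℂ 2 (cellMeasure d) :=
  (orthonormal_trig d).orthogonalFamily.linearIsometry

theorem synthH_apply {d : ℕ} (b : Hil d) : synthH d b = synth (b : Coeff d) := by
  rw [synthH, OrthogonalFamily.linearIsometry_apply, synth]
  simp

/-! ### The components of the gradient -/

theorem wt_sq {d : ℕ} (k : Idx d) : wt k ^ 2 = 1 + ∑ j, (k j : ℝ) ^ 2 := by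
  have h : 0 ≤ ∑ j, (k j : ℝ) ^ 2 := Finset.sum_nonneg fun _ _ => sq_nonneg _
  rw [wt, len, Real.sq_sqrt h, Real.sq_sqrt (by positivity)]

theorem wt_pos {d : ℕ} (k : Idx d) : 0 < wt k :=
  Real.sqrt_pos.2 (by positivity)

theorem norm_inv_wt_le {d : ℕ} (k : Idx d) : ‖((wt k : ℂ))⁻¹‖ ≤ 1 := by
  rw [norm_inv, Complex.norm_real, Real.norm_of_nonneg (wt_pos k).le]
  refine inv_le_one_of_one_le₀ ?_
  refine abs_le_of_sq_le_sq' ?_ (wt_pos k).le |>.2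
  rw [wt_sq]
  have h : 0 ≤ ∑ j, (k j : ℝ) ^ 2 := Finset.sum_nonneg fun _ _ => sq_nonneg _
  linarith

theorem norm_coord_div_wt_le {d : ℕ} (j : Fin d) (k : Idx d) :
    ‖Complex.I * (k j : ℂ) * ((wt k : ℂ))⁻¹‖ ≤ 1 := by
  rw [norm_mul, norm_mul, Complex.norm_I, one_mul, norm_inv, Complex.norm_real,
    Real.norm_of_nonneg (wt_pos k).le, ← div_eq_mul_inv, div_le_one (wt_pos k),
    Complex.norm_intCast]
  refine abs_le_of_sq_le_sq' ?_ (wt_pos k).le |>.2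
  rw [sq_abs, wt_sq]
  have h := Finset.single_le_sum (f := fun j => (k j : ℝ) ^ 2) (fun _ _ => sq_nonneg _)
    (Finset.mem_univ j)
  linarith

/-- The embedding of `H¹_p(Ω)` into `L²(Ω)`. -/
def funcH (d : ℕ) : Hil d →L[ℂ] Lp ℂ 2 (cellMeasure d) :=
  (synthH d).toContinuousLinearMap ∘L diagOp _ norm_inv_wt_le

/-- The partial derivatives as operators on `H¹_p(Ω)`. -/
def pderivH {d : ℕ} (j : Fin d) : Hil d →L[ℂ] Lp ℂ 2 (cellMeasure d) :=
  (synthH d).toContinuousLinearMap ∘L diagOp _ (norm_coord_div_wt_le j)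

theorem funcH_apply {d : ℕ} (v : Hil d) : funcH d v = func (v : Coeff d) := by
  have h : (diagOp _ norm_inv_wt_le v : Coeff d) = fun k => v k / (wt k : ℂ) :=
    funext fun k => by rw [diagOp_apply]; ring
  rw [func, ← h, ← synthH_apply]
  rfl

theorem pderivH_apply {d : ℕ} (j : Fin d) (v : Hil d) : pderivH j v = pderiv (v : Coeff d) j := by
  have h : (diagOp _ (norm_coord_div_wt_le j) v : Coeff d) =
      fun k => Complex.I * (k j : ℂ) * (v k / (wt k : ℂ)) :=
    funext fun k => by rw [diagOp_apply]; ring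
  rw [pderiv, ← h, ← synthH_apply]
  rfl

/-- Parseval together with (|k|² + 1) / c_k² = 1: the normalized ℓ² norm is the H¹ norm, so bounds
on the coefficients become spectral bounds on A. -/
theorem norm_sq_pderivH_add {d : ℕ} (v : Hil d) :
    ∑ j, ‖pderivH j v‖ ^ 2 + ‖funcH d v‖ ^ 2 = ‖v‖ ^ 2 := by
  have h1 : ‖funcH d v‖ = ‖diagOp _ norm_inv_wt_le v‖ := (synthH d).norm_map _
  have h2 : ∀ j, ‖pderivH j v‖ = ‖diagOp _ (norm_coord_div_wt_le j) v‖ :=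
    fun j => (synthH d).norm_map _
  simp_rw [h1, h2, norm_sq_eq_tsum]
  rw [← Summable.tsum_finsetSum fun j _ => summable_sq _, ← Summable.tsum_add
    (summable_sum fun j _ => summable_sq _) (summable_sq _)]
  refine tsum_congr fun k => ?_
  simp_rw [diagOp_apply, norm_mul, mul_pow, norm_inv, Complex.norm_real, Complex.norm_I,
    Complex.norm_intCast, Real.norm_of_nonneg (wt_pos k).le, sq_abs]
  rw [← Finset.sum_mul, ← add_mul, ← Finset.sum_mul]
  have h3 := wt_sq k
  have h4 := wt_pos k
  rw [one_pow, ← Finset.mul_sum, ← add_one_mul, one_mul]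
  have h5 : (∑ j, (k j : ℝ) ^ 2) + 1 = wt k ^ 2 := by rw [h3]; ring
  rw [h5]
  field_simp

/-! ### Multiplication operators on `L²(Ω)` -/

/-- A real measurable function with values between `lo > 0` and `hi` on the cell. -/
structure IsCoefficient {d : ℕ} (g : (Fin d → ℝ) → ℝ) (lo hi : ℝ) : Prop where
  meas : Measurable g
  lo_pos : 0 < lo
  bounds : ∀ x ∈ cell d, lo ≤ g x ∧ g x ≤ hi

variable {d : ℕ} {g : (Fin d → ℝ) → ℝ} {lo hi : ℝ}

theorem measurableSet_cell (d : ℕ) : MeasurableSet (cell d) :=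
  MeasurableSet.univ_pi fun _ => measurableSet_Ioo

theorem IsCoefficient.ae_bounds (hg : IsCoefficient g lo hi) :
    ∀ᵐ x ∂(cellMeasure d), lo ≤ g x ∧ g x ≤ hi := by
  filter_upwards [ae_restrict_mem (measurableSet_cell d)] with x hx using hg.bounds x hx

theorem IsCoefficient.ae_norm_mul_le (hg : IsCoefficient g lo hi)
    (f : Lp ℂ 2 (cellMeasure d)) : ∀ᵐ x ∂(cellMeasure d), ‖(g x : ℂ) * f x‖ ≤ hi * ‖f x‖ := by
  filter_upwards [hg.ae_bounds] with x hx
  rw [norm_mul, Complex.norm_real, Real.norm_of_nonneg (hg.lo_pos.le.trans hx.1)]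
  gcongr
  exact hx.2

theorem IsCoefficient.memLp_mul (hg : IsCoefficient g lo hi) (f : Lp ℂ 2 (cellMeasure d)) :
    MemLp (fun x => (g x : ℂ) * f x) 2 (cellMeasure d) :=
  MemLp.of_le_mul (Lp.memLp f)
    ((Complex.measurable_ofReal.comp hg.meas).aestronglyMeasurable.mul (Lp.aestronglyMeasurable f))
    (hg.ae_norm_mul_le f)

/-- Multiplication by a coefficient, as a linear map of `L²(Ω)`. -/
def IsCoefficient.mulLin (hg : IsCoefficient g lo hi) :
    Lp ℂ 2 (cellMeasure d) →ₗ[ℂ] Lp ℂ 2 (cellMeasure d) where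
  toFun f := (hg.memLp_mul f).toLp _
  map_add' f h := by
    rw [← MemLp.toLp_add]
    refine MemLp.toLp_congr _ _ ?_
    filter_upwards [Lp.coeFn_add f h] with x hx
    rw [hx, Pi.add_apply, Pi.add_apply, mul_add]
  map_smul' c f := by
    rw [← MemLp.toLp_const_smul]
    refine MemLp.toLp_congr _ _ ?_
    filter_upwards [Lp.coeFn_smul c f] with x hx
    rw [hx, Pi.smul_apply, Pi.smul_apply]
    exact mul_left_comm _ _ _

theorem IsCoefficient.mulLin_coe (hg : IsCoefficient g lo hi) (f : Lp ℂ 2 (cellMeasure d)) :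
    hg.mulLin f =ᵐ[cellMeasure d] fun x => (g x : ℂ) * f x := (hg.memLp_mul f).coeFn_toLp

theorem IsCoefficient.norm_mulLin_le (hg : IsCoefficient g lo hi)
    (f : Lp ℂ 2 (cellMeasure d)) : ‖hg.mulLin f‖ ≤ hi * ‖f‖ := by
  refine Lp.norm_le_mul_norm_of_ae_le_mul ?_
  filter_upwards [hg.mulLin_coe f, hg.ae_norm_mul_le f] with x h1 h2
  rwa [h1]

/-- Multiplication by a coefficient, as a continuous operator on `L²(Ω)`. -/
def IsCoefficient.mulOp (hg : IsCoefficient g lo hi) :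
    Lp ℂ 2 (cellMeasure d) →L[ℂ] Lp ℂ 2 (cellMeasure d) :=
  hg.mulLin.mkContinuous hi hg.norm_mulLin_le

theorem IsCoefficient.inner_mulOp (hg : IsCoefficient g lo hi) (f h : Lp ℂ 2 (cellMeasure d)) :
    inner ℂ h (hg.mulOp f) = ∫ x, (g x : ℂ) * (f x * conj (h x)) ∂(cellMeasure d) := by
  rw [L2.inner_def]
  refine integral_congr_ae ?_
  filter_upwards [hg.mulLin_coe f] with x hx
  have : hg.mulOp f x = (g x : ℂ) * f x := hx
  rw [this, RCLike.inner_apply]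
  ring

theorem IsCoefficient.integrable (hg : IsCoefficient g lo hi) (f h : Lp ℂ 2 (cellMeasure d)) :
    Integrable (fun x => (g x : ℂ) * (f x * conj (h x))) (cellMeasure d) := by
  refine (L2.integrable_inner (𝕜 := ℂ) h (hg.mulOp f)).congr ?_
  filter_upwards [hg.mulLin_coe f] with x hx
  have : hg.mulOp f x = (g x : ℂ) * f x := hx
  rw [this, RCLike.inner_apply]
  ring

theorem IsCoefficient.inner_mulOp_symm (hg : IsCoefficient g lo hi)
    (f h : Lp ℂ 2 (cellMeasure d)) : inner ℂ h (hg.mulOp f) = inner ℂ (hg.mulOp h) f := by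
  rw [← inner_conj_symm (hg.mulOp h) f, hg.inner_mulOp, hg.inner_mulOp, ← integral_conj]
  congr 1
  funext x
  simp only [map_mul, Complex.conj_ofReal, Complex.conj_conj]
  ring

theorem IsCoefficient.le_re_inner_mulOp (hg : IsCoefficient g lo hi)
    (f : Lp ℂ 2 (cellMeasure d)) : lo * ‖f‖ ^ 2 ≤ (inner ℂ f (hg.mulOp f)).re := by
  have h2 : ‖f‖ ^ 2 = ∫ x, ‖f x‖ ^ 2 ∂(cellMeasure d) := by
    have := inner_self_eq_norm_sq_to_K (𝕜 := ℂ) f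
    rw [L2.inner_def] at this
    simp_rw [inner_self_eq_norm_sq_to_K] at this
    have h3 : ((∫ x, ‖f x‖ ^ 2 ∂(cellMeasure d) : ℝ) : ℂ) = ((‖f‖ ^ 2 : ℝ) : ℂ) := by
      rw [← integral_complex_ofReal]
      push_cast
      exact this
    exact_mod_cast h3.symm
  have hre : ∀ x, ((g x : ℂ) * (f x * conj (f x))).re = g x * ‖f x‖ ^ 2 := by
    intro x
    rw [Complex.mul_conj, ← Complex.ofReal_mul, Complex.ofReal_re, Complex.normSq_eq_norm_sq]
  have hi1 := (hg.integrable f f).re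
  have h4 : (inner ℂ f (hg.mulOp f)).re = ∫ x, g x * ‖f x‖ ^ 2 ∂(cellMeasure d) := by
    rw [hg.inner_mulOp]
    have := integral_re (hg.integrable f f)
    simp only [RCLike.re_eq_complex_re, hre] at this
    exact this.symm
  simp only [RCLike.re_eq_complex_re, hre] at hi1
  rw [h4, h2, ← integral_const_mul]
  have hi2 : Integrable (fun x => ‖f x‖ ^ 2) (cellMeasure d) := by
    have := (Lp.memLp f).integrable_norm_pow (by norm_num)
    simpa using this
  refine integral_mono_ae (hi2.const_mul _) hi1 ?_
  filter_upwards [hg.ae_bounds] with x hx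
  gcongr
  exact hx.1

theorem IsCoefficient.norm_inner_mulOp_le (hg : IsCoefficient g lo hi)
    (f h : Lp ℂ 2 (cellMeasure d)) : ‖inner ℂ h (hg.mulOp f)‖ ≤ hi * (‖f‖ * ‖h‖) := by
  refine (norm_inner_le_norm _ _).trans ?_
  have := hg.norm_mulLin_le f
  have h2 : ‖hg.mulOp f‖ ≤ hi * ‖f‖ := this
  nlinarith [norm_nonneg h]

/-! ### The stiffness operator -/

theorem EllipticData.isCoefficient_ν (D : EllipticData d) : IsCoefficient D.ν D.νlo D.νhi :=
  ⟨D.measurable_ν, D.νlo_pos, D.ν_bounds⟩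

theorem EllipticData.isCoefficient_σ (D : EllipticData d) : IsCoefficient D.σ D.σlo D.σhi :=
  ⟨D.measurable_σ, D.σlo_pos, D.σ_bounds⟩

/-- The operator of the elliptic problem in normalized coefficients. -/
def opA (D : EllipticData d) : Hil d →L[ℂ] Hil d :=
  ∑ j, (pderivH j).adjoint ∘L D.isCoefficient_ν.mulOp ∘L pderivH j +
    (funcH d).adjoint ∘L D.isCoefficient_σ.mulOp ∘L funcH d

theorem inner_opA_eq_sum (D : EllipticData d) (v w : Hil d) :
    inner ℂ w (opA D v) =
      ∑ j, inner ℂ (pderivH j w) (D.isCoefficient_ν.mulOp (pderivH j v)) +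
        inner ℂ (funcH d w) (D.isCoefficient_σ.mulOp (funcH d v)) := by
  simp only [opA, add_apply, sum_apply,
    ContinuousLinearMap.comp_apply, inner_add_right, inner_sum,
    ContinuousLinearMap.adjoint_inner_right]

/-- The bridge from integrals to operator theory; beyond this point the form enters only through the
self-adjointness of `opA D` and its two bounds. -/
theorem form_eq_inner (D : EllipticData d) (v w : Hil d) :
    form D (v : Coeff d) w = inner ℂ w (opA D v) := by
  rw [inner_opA_eq_sum, form]
  simp_rw [Finset.mul_sum]
  rw [integral_finsetSum]
  · simp_rw [IsCoefficient.inner_mulOp, funcH_apply, pderivH_apply]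
  · intro j _
    rw [← pderivH_apply, ← pderivH_apply]
    exact D.isCoefficient_ν.integrable _ _

theorem inner_opA_symm (D : EllipticData d) (v w : Hil d) :
    inner ℂ w (opA D v) = inner ℂ (opA D w) v := by
  rw [← inner_conj_symm (opA D w) v, inner_opA_eq_sum, inner_opA_eq_sum, map_add, map_sum]
  congr 1
  · refine Finset.sum_congr rfl fun j _ => ?_
    rw [inner_conj_symm, IsCoefficient.inner_mulOp_symm]
  · rw [inner_conj_symm, IsCoefficient.inner_mulOp_symm]

theorem αlo_pos (D : EllipticData d) : 0 < D.αlo := lt_min D.νlo_pos D.σlo_pos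

theorem αlo_le_αhi (D : EllipticData d) : D.αlo ≤ D.αhi := by
  -- The lower and upper bounds can only be compared at a point of the cell.
  have hx : (fun _ : Fin d => (1 : ℝ)) ∈ cell d := by
    intro j _
    exact ⟨one_pos, by nlinarith [Real.pi_gt_three]⟩
  have h := D.ν_bounds _ hx
  exact (min_le_left _ _).trans ((h.1.trans h.2).trans (le_max_left _ _))

theorem αhi_pos (D : EllipticData d) : 0 < D.αhi := (αlo_pos D).trans_le (αlo_le_αhi D)

theorem αlo_mul_le (D : EllipticData d) (v : Hil d) :
    D.αlo * ‖v‖ ^ 2 ≤ (inner ℂ v (opA D v)).re := by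
  rw [inner_opA_eq_sum, Complex.add_re, Complex.re_sum, ← norm_sq_pderivH_add, mul_add,
    Finset.mul_sum]
  refine add_le_add (Finset.sum_le_sum fun j _ => ?_) ?_
  · refine le_trans ?_ (D.isCoefficient_ν.le_re_inner_mulOp _)
    gcongr
    exact min_le_left _ _
  · refine le_trans ?_ (D.isCoefficient_σ.le_re_inner_mulOp _)
    gcongr
    exact min_le_right _ _

theorem norm_inner_opA_le (D : EllipticData d) (v w : Hil d) :
    ‖inner ℂ w (opA D v)‖ ≤ D.αhi * (‖v‖ * ‖w‖) := by
  have h1 : ‖inner ℂ w (opA D v)‖ ≤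
      D.αhi * (∑ j, ‖pderivH j v‖ * ‖pderivH j w‖ + ‖funcH d v‖ * ‖funcH d w‖) := by
    rw [inner_opA_eq_sum, mul_add, Finset.mul_sum]
    refine (norm_add_le _ _).trans (add_le_add ((norm_sum_le _ _).trans
      (Finset.sum_le_sum fun j _ => ?_)) ?_)
    · refine (D.isCoefficient_ν.norm_inner_mulOp_le _ _).trans ?_
      gcongr
      exact le_max_left _ _
    · refine (D.isCoefficient_σ.norm_inner_mulOp_le _ _).trans ?_
      gcongr
      exact le_max_right _ _
  refine h1.trans (mul_le_mul_of_nonneg_left ?_ (αhi_pos D).le)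
  have hv := norm_sq_pderivH_add v
  have hw := norm_sq_pderivH_add w
  refine abs_le_of_sq_le_sq' ?_ (by positivity) |>.2
  -- One Cauchy-Schwarz inequality for d + 1 components; `none` stands for the function and `some j`
  -- for its derivatives.
  have h2 := Finset.sum_mul_sq_le_sq_mul_sq Finset.univ
    (fun o : Option (Fin d) => o.elim ‖funcH d v‖ fun j => ‖pderivH j v‖)
    (fun o : Option (Fin d) => o.elim ‖funcH d w‖ fun j => ‖pderivH j w‖)
  simp only [Fintype.sum_option, Option.elim] at h2
  rw [mul_pow, ← hv, ← hw]
  rw [add_comm (∑ j, ‖pderivH j v‖ * ‖pderivH j w‖), add_comm (∑ j, ‖pderivH j v‖ ^ 2),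
    add_comm (∑ j, ‖pderivH j w‖ ^ 2)]
  exact h2

theorem norm_opA_apply_le (D : EllipticData d) (v : Hil d) : ‖opA D v‖ ≤ D.αhi * ‖v‖ := by
  have h := norm_inner_opA_le D v (opA D v)
  rw [inner_self_eq_norm_sq_to_K] at h
  norm_num at h
  rcases (norm_nonneg (opA D v)).eq_or_lt with h0 | h0
  · rw [← h0]
    have := αhi_pos D
    positivity
  · nlinarith

theorem αlo_mul_norm_le (D : EllipticData d) (v : Hil d) : D.αlo * ‖v‖ ≤ ‖opA D v‖ := by
  have h1 := αlo_mul_le D v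
  have h2 := (Complex.re_le_norm _).trans (norm_inner_le_norm (𝕜 := ℂ) v (opA D v))
  rcases (norm_nonneg v).eq_or_lt with h0 | h0
  · rw [← h0, mul_zero]
    positivity
  · nlinarith

theorem isSolution_iff (D : EllipticData d) (F u : Hil d) :
    IsSolution D (F : Coeff d) u ↔ opA D u = F := by
  constructor
  · intro h
    refine ext_inner_left ℂ fun v => ?_
    rw [← form_eq_inner, h.2 v (memV_coe v), inner_eq_pairing]
  · intro h
    refine ⟨memV_coe u, fun v hv => ?_⟩
    obtain ⟨v, rfl⟩ := exists_hil hv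
    rw [form_eq_inner, h, inner_eq_pairing]

theorem isGalerkin_iff (D : EllipticData d) (F w : Hil d) (Λ : Finset (Idx d)) :
    IsGalerkin D (F : Coeff d) Λ w ↔
      MemSpan Λ w ∧ ∀ v : Hil d, MemSpan Λ v → inner ℂ v (opA D w) = inner ℂ v F := by
  refine and_congr_right fun _ => ⟨fun h v hv => ?_, fun h v hv => ?_⟩
  · rw [← form_eq_inner, h v hv, inner_eq_pairing]
  · obtain ⟨v, rfl⟩ := exists_hil (memV_of_memSpan hv)
    rw [form_eq_inner, h v hv, inner_eq_pairing]

theorem coe_residual (D : EllipticData d) (F w : Hil d) :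
    residual D (F : Coeff d) w = (F - opA D w : Hil d) := by
  funext k
  rw [residual, ← coe_unitH, form_eq_inner, inner_unitH_left]
  rfl

theorem stiffness_eq (D : EllipticData d) (l k : Idx d) :
    stiffness D l k = opA D (unitH k) l := by
  rw [stiffness, ← coe_unitH, ← coe_unitH, form_eq_inner, inner_unitH_left]

/-! ### Quasi-optimality of Galerkin solutions -/

theorem MemSpan.mono {d : ℕ} {Λ Λ' : Finset (Idx d)} (h : Λ ⊆ Λ') {v : Coeff d}
    (hv : MemSpan Λ v) : MemSpan Λ' v := fun k hk => hv k fun hk' => hk (h hk')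

theorem MemSpan.add {d : ℕ} {Λ : Finset (Idx d)} {v w : Hil d} (hv : MemSpan Λ (v : Coeff d))
    (hw : MemSpan Λ (w : Coeff d)) : MemSpan Λ ((v + w : Hil d) : Coeff d) := fun k hk => by
  rw [lp.coeFn_add, Pi.add_apply, hv k hk, hw k hk, add_zero]

theorem MemSpan.sub {d : ℕ} {Λ : Finset (Idx d)} {v w : Hil d} (hv : MemSpan Λ (v : Coeff d))
    (hw : MemSpan Λ (w : Coeff d)) : MemSpan Λ ((v - w : Hil d) : Coeff d) := fun k hk => by
  rw [lp.coeFn_sub, Pi.sub_apply, hv k hk, hw k hk, sub_zero]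

theorem MemSpan.smul {d : ℕ} {Λ : Finset (Idx d)} {v : Hil d} (c : ℂ)
    (hv : MemSpan Λ (v : Coeff d)) : MemSpan Λ ((c • v : Hil d) : Coeff d) := fun k hk => by
  rw [lp.coeFn_smul, Pi.smul_apply, hv k hk, smul_zero]

theorem MemSpan.zero {d : ℕ} (Λ : Finset (Idx d)) : MemSpan Λ ((0 : Hil d) : Coeff d) :=
  fun _ _ => rfl

theorem MemSpan.sum {d : ℕ} {ι : Type*} {Λ : Finset (Idx d)} {s : Finset ι} {f : ι → Hil d}
    (hf : ∀ i ∈ s, MemSpan Λ (f i : Coeff d)) : MemSpan Λ ((∑ i ∈ s, f i : Hil d) : Coeff d) :=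
  fun k hk => by
  rw [lp.coeFn_sum, Finset.sum_apply]
  exact Finset.sum_eq_zero fun i hi => hf i hi k hk

/-- Galerkin orthogonality makes u - w and w - z orthogonal for the form, so Pythagoras holds in
energy. The space V_Λ is arbitrary, so this serves both predictor and corrector. -/
theorem energy_galerkin_le (D : EllipticData d) {F u w z : Hil d} {Λ : Finset (Idx d)}
    (hu : opA D u = F) (hw : IsGalerkin D (F : Coeff d) Λ w) (hz : MemSpan Λ (z : Coeff d)) :
    (inner ℂ (u - w) (opA D (u - w))).re ≤ (inner ℂ (u - z) (opA D (u - z))).re := by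
  rw [isGalerkin_iff] at hw
  have h0 : inner ℂ (w - z) (opA D (u - w)) = 0 := by
    rw [map_sub, inner_sub_right, hw.2 _ (hw.1.sub hz), hu, sub_self]
  have h1 : inner ℂ (u - w) (opA D (w - z)) = 0 := by
    rw [inner_opA_symm, ← inner_conj_symm, h0, map_zero]
  have h2 : u - z = (u - w) + (w - z) := by abel
  rw [h2, map_add, inner_add_left, inner_add_right, inner_add_right, h0, h1, zero_add, add_zero,
    Complex.add_re]
  have h3 := αlo_mul_le D (w - z)
  have h4 : 0 ≤ D.αlo * ‖w - z‖ ^ 2 := by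
    have := αlo_pos D
    positivity
  linarith

theorem energy_le (D : EllipticData d) (v : Hil d) :
    (inner ℂ v (opA D v)).re ≤ D.αhi * ‖v‖ ^ 2 := by
  refine (Complex.re_le_norm _).trans ((norm_inner_opA_le D v v).trans ?_)
  rw [sq]

theorem norm_sub_galerkin_le (D : EllipticData d) {F u w z : Hil d} {Λ : Finset (Idx d)}
    (hu : opA D u = F) (hw : IsGalerkin D (F : Coeff d) Λ w) (hz : MemSpan Λ (z : Coeff d)) :
    ‖u - w‖ ≤ D.αhi / D.αlo * ‖u - z‖ := by
  have h1 := (αlo_mul_le D (u - w)).trans ((energy_galerkin_le D hu hw hz).trans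
    (energy_le D (u - z)))
  have hlo := αlo_pos D
  have hhi := αhi_pos D
  have hle := αlo_le_αhi D
  refine abs_le_of_sq_le_sq' ?_ (by positivity) |>.2
  rw [mul_pow, div_pow, div_mul_eq_mul_div, le_div_iff₀ (by positivity)]
  have h2 : D.αlo * (D.αlo * ‖u - w‖ ^ 2) ≤ D.αhi * (D.αhi * ‖u - z‖ ^ 2) := by gcongr
  nlinarith

theorem norm_sub_galerkin_le_norm (D : EllipticData d) {F u w : Hil d} {Λ : Finset (Idx d)}
    (hu : opA D u = F) (hw : IsGalerkin D (F : Coeff d) Λ w) :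
    ‖u - w‖ ≤ D.αhi / D.αlo * ‖u‖ := by
  simpa using norm_sub_galerkin_le D hu hw (MemSpan.zero Λ)

/-! ### Bounded matrices -/

theorem sum_onFinset {d : ℕ} (S : Finset (Idx d)) (c : Coeff d) (hc : ∀ k, c k ≠ 0 → k ∈ S)
    (f : Idx d → ℂ → ℂ) (hf : ∀ k, f k 0 = 0) :
    ∑ k ∈ (Finsupp.onFinset S c hc).support, f k (Finsupp.onFinset S c hc k) =
      ∑ k ∈ S, f k (c k) := by
  refine Finset.sum_subset Finsupp.support_onFinset_subset fun k _ hk => ?_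
  rw [Finsupp.notMem_support_iff.1 hk, hf]

theorem MatNormLE.nonneg {d : ℕ} {B : Idx d → Idx d → ℂ} {M : ℝ} (h : MatNormLE B M) :
    0 ≤ M := by
  have h1 := (norm_nonneg _).trans (h (Finsupp.single 0 1) (Finsupp.single 0 1))
  have h2 : ((Finsupp.single 0 1 : Idx d →₀ ℂ) : Coeff d) = unitH 0 := by
    rw [coe_unitH, unitVec]
    exact Finsupp.single_eq_pi_single _ _
  rw [h2, nrm_coe, norm_unitH] at h1
  linarith

/-- Test the bilinear bound with P_Y b: it gives ‖P_Y b‖² ≤ M ‖P_S r‖ ‖P_Y b‖ for every finite Y;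
cancel a factor and exhaust. -/
theorem MatNormLE.norm_le {d : ℕ} {B : Idx d → Idx d → ℂ} {M : ℝ} (h : MatNormLE B M)
    {S : Finset (Idx d)} {r b : Hil d} (hb : ∀ l, b l = ∑ k ∈ S, B l k * r k) :
    ‖b‖ ≤ M * ‖projH S r‖ := by
  have hM := h.nonneg
  refine norm_le_of_forall_projH_le (by positivity) fun Y => ?_
  have hmem : ∀ (T : Finset (Idx d)) (v : Hil d) (k : Idx d), projH T v k ≠ 0 → k ∈ T :=
    fun T v k hk => by
      by_contra h'
      exact hk (memSpan_projH T v k h')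
  have h1 := h (Finsupp.onFinset S (projH S r) (hmem S r)) (Finsupp.onFinset Y (projH Y b) (hmem Y b))
  have h2 : ∀ l, ∑ k ∈ (Finsupp.onFinset S (projH S r) (hmem S r)).support,
      conj (Finsupp.onFinset Y (projH Y b) (hmem Y b) l) * B l k *
        Finsupp.onFinset S (projH S r) (hmem S r) k =
      conj (Finsupp.onFinset Y (projH Y b) (hmem Y b) l) * b l := by
    intro l
    rw [sum_onFinset S (projH S r) (hmem S r)
      (fun k x => conj (Finsupp.onFinset Y (projH Y b) (hmem Y b) l) * B l k * x)
      (fun k => mul_zero _), hb, Finset.mul_sum]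
    refine Finset.sum_congr rfl fun k hk => ?_
    rw [projH_apply, if_pos hk, mul_assoc]
  simp_rw [h2] at h1
  rw [sum_onFinset Y (projH Y b) (hmem Y b) (fun l x => conj x * b l) (fun k => by simp),
    Finsupp.coe_onFinset, Finsupp.coe_onFinset, nrm_coe, nrm_coe] at h1
  have h3 : ∑ l ∈ Y, conj (projH Y b l) * b l = ((‖projH Y b‖ ^ 2 : ℝ) : ℂ) := by
    have h4 := inner_self_eq_norm_sq_to_K (𝕜 := ℂ) (projH Y b)
    rw [inner_projH_left b (memSpan_projH Y b), lp.inner_eq_tsum, tsum_eq_sum (s := Y)] at h4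
    · push_cast
      rw [← RCLike.ofReal_eq_complex_ofReal, ← h4]
      refine Finset.sum_congr rfl fun l _ => ?_
      rw [RCLike.inner_apply, mul_comm]
    · intro l hl
      rw [memSpan_projH Y b l hl, inner_zero_left]
  rw [h3, Complex.norm_real, Real.norm_of_nonneg (by positivity)] at h1
  rcases (norm_nonneg (projH Y b)).eq_or_lt with h0 | h0
  · rw [← h0]
    positivity
  · nlinarith

/-! ### The predictor step -/

/-- The quadratic form of A - α_* vanishes, squeezed between its bounds and real by symmetry; over ℂ
this forces A = α_*. -/
theorem opA_eq_smul (D : EllipticData d) (h : D.αlo = D.αhi) (v : Hil d) :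
    opA D v = (D.αlo : ℂ) • v := by
  have h1 : ((opA D : Hil d →ₗ[ℂ] Hil d) - (D.αlo : ℂ) • LinearMap.id) = 0 := by
    rw [← inner_map_self_eq_zero]
    intro x
    have h2 : (inner ℂ x (opA D x)).im = 0 := by
      have h3 := inner_opA_symm D x x
      rw [← inner_conj_symm (opA D x) x] at h3
      exact Complex.conj_eq_iff_im.1 h3.symm
    have h3 : (inner ℂ x (opA D x)).re = D.αlo * ‖x‖ ^ 2 :=
      le_antisymm (h ▸ energy_le D x) (αlo_mul_le D x)
    have h4 : inner ℂ x (opA D x) = ((D.αlo * ‖x‖ ^ 2 : ℝ) : ℂ) :=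
      Complex.ext (by rw [h3, Complex.ofReal_re]) (by rw [h2, Complex.ofReal_im])
    rw [LinearMap.sub_apply, inner_sub_left, LinearMap.smul_apply, LinearMap.id_apply,
      inner_smul_left, inner_self_eq_norm_sq_to_K, ContinuousLinearMap.coe_coe, ← inner_opA_symm,
      h4, Complex.conj_ofReal]
    push_cast
    exact sub_self _
  have h2 := LinearMap.congr_fun h1 v
  rw [LinearMap.sub_apply, LinearMap.zero_apply, sub_eq_zero] at h2
  exact h2

theorem len_zero {d : ℕ} : len (0 : Idx d) = 0 := by simp [len]

theorem IsEnrich.subset {d : ℕ} {S E : Finset (Idx d)} {J : ℕ} (h : IsEnrich S J E) : S ⊆ E :=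
  fun k hk => (h k).2 ⟨k, hk, by rw [sub_self, len_zero]; positivity⟩

/-- When A = α_* the exact correction is r/α_*, and w + P_S r / α_* already lies in the predictor
space, so only the unmarked part of r remains in the error. -/
theorem predictor_of_eq (D : EllipticData d) (h : D.αlo = D.αhi) {F u w w' : Hil d}
    {Λ S Λ' : Finset (Idx d)} {s : ℝ} (hu : opA D u = F) (hw : MemSpan Λ (w : Coeff d))
    (hs : ‖(F - opA D w) - projH S (F - opA D w)‖ ≤ s) (hΛ : Λ ⊆ Λ') (hS : S ⊆ Λ')
    (hw' : IsGalerkin D (F : Coeff d) Λ' w') : ‖u - w'‖ ≤ 1 / D.αlo * s := by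
  have hlo := αlo_pos D
  set r := F - opA D w with hr
  have hr' : r = (D.αlo : ℂ) • (u - w) := by
    rw [hr, ← hu, ← map_sub, opA_eq_smul D h]
  have hc : (D.αlo : ℂ) ≠ 0 := by exact_mod_cast hlo.ne'
  set z := w + ((D.αlo : ℂ))⁻¹ • projH S r with hz
  have hzm : MemSpan Λ' (z : Coeff d) :=
    (hw.mono hΛ).add ((memSpan_projH S r).mono hS |>.smul _)
  have h1 := norm_sub_galerkin_le D hu hw' hzm
  have h2 : u - z = ((D.αlo : ℂ))⁻¹ • (r - projH S r) := by
    rw [smul_sub, hz]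
    nth_rewrite 2 [hr']
    rw [smul_smul, inv_mul_cancel₀ hc, one_smul]
    abel
  rw [h2, norm_smul, norm_inv, Complex.norm_real, Real.norm_of_nonneg hlo.le, ← h,
    div_self hlo.ne', one_mul] at h1
  refine h1.trans ?_
  rw [one_div]
  gcongr

/-- The error of the competitor w + z is a + b with A a the unmarked residual, of norm at most s,
and b = y - z the truncation error, at most βs. In energy the squares contribute s²/α_* each, by the
choice of β, and each cross term at most ‖b‖ ‖A a‖ ≤ βs². This use of ‖A a‖, instead of
Cauchy-Schwarz in energy, is what leaves room below the factor 2. -/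
theorem predictor_of_bound (D : EllipticData d) {u w w' y z : Hil d} {F : Hil d}
    {Λ' : Finset (Idx d)} {s β : ℝ} (hs : 0 ≤ s) (hβ : 0 ≤ β)
    (hβ2 : D.αhi * D.αlo * β ^ 2 = 1) (hu : opA D u = F)
    (hw : MemSpan Λ' (w : Coeff d)) (hz : MemSpan Λ' (z : Coeff d))
    (hy : ‖F - opA D w - opA D y‖ ≤ s) (hyz : ‖y - z‖ ≤ β * s)
    (hw' : IsGalerkin D (F : Coeff d) Λ' w') :
    ‖u - w'‖ ≤ Real.sqrt (2 + 2 * (D.αlo * β)) * (1 / D.αlo * s) := by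
  have hlo := αlo_pos D
  have hhi := αhi_pos D
  have h1 := (αlo_mul_le D (u - w')).trans (energy_galerkin_le D hu hw' (hw.add hz))
  set a := u - w - y with ha
  set b := y - z with hb
  have hA : opA D a = F - opA D w - opA D y := by rw [ha, map_sub, map_sub, hu]
  have hab : u - (w + z) = a + b := by rw [ha, hb]; abel
  rw [← hA] at hy
  have hna : ‖a‖ ≤ s / D.αlo := by
    rw [le_div_iff₀ hlo, mul_comm]
    exact (αlo_mul_norm_le D a).trans hy
  have e1 : (inner ℂ a (opA D a)).re ≤ s / D.αlo * s :=
    (Complex.re_le_norm _).trans ((norm_inner_le_norm _ _).trans (by gcongr))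
  have e2 : (inner ℂ b (opA D a)).re ≤ β * s * s :=
    (Complex.re_le_norm _).trans ((norm_inner_le_norm _ _).trans (by gcongr))
  have e3 : (inner ℂ a (opA D b)).re ≤ β * s * s := by
    rw [inner_opA_symm, ← inner_conj_symm, Complex.conj_re]
    exact e2
  have e4 : (inner ℂ b (opA D b)).re ≤ D.αhi * (β * s) ^ 2 :=
    (energy_le D b).trans (by gcongr)
  rw [hab, map_add, inner_add_left, inner_add_right, inner_add_right, Complex.add_re,
    Complex.add_re, Complex.add_re] at h1
  have e5 : D.αlo * ‖u - w'‖ ^ 2 ≤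
      s / D.αlo * s + β * s * s + (β * s * s + D.αhi * (β * s) ^ 2) := by linarith
  have e6 : D.αlo * (s / D.αlo * s + β * s * s + (β * s * s + D.αhi * (β * s) ^ 2)) =
      (2 + 2 * (D.αlo * β)) * s ^ 2 := by
    have : D.αlo * (s / D.αlo * s) = s ^ 2 := by field_simp
    linear_combination this + s ^ 2 * hβ2
  refine abs_le_of_sq_le_sq' ?_ (by positivity) |>.2
  rw [mul_pow, Real.sq_sqrt (by positivity)]
  have e7 : (2 + 2 * (D.αlo * β)) * (1 / D.αlo * s) ^ 2 =
      (2 + 2 * (D.αlo * β)) * s ^ 2 / D.αlo ^ 2 := by ring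
  rw [e7, le_div_iff₀ (by positivity), ← e6]
  nlinarith [mul_le_mul_of_nonneg_left e5 hlo.le]

/-- Here y = A⁻¹ P_S r is a combination of the columns of A⁻¹ and z is the same combination of the
truncated columns, which live on the enriched set. -/
theorem exists_truncated_inverse (D : EllipticData d) {B : Idx d → Idx d → ℂ} {ψ : ℕ → ℝ} {J : ℕ}
    (hB : IsInverseStiffness D B) (hψ : MatNormLE (fun l k => B l k - trunc B J l k) (ψ J))
    {S E : Finset (Idx d)} (hE : IsEnrich S J E) (r : Hil d) :
    ∃ y z : Hil d, opA D y = projH S r ∧ MemSpan E (z : Coeff d) ∧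
      ‖y - z‖ ≤ ψ J * ‖projH S r‖ := by
  classical
  choose b hb using fun k => exists_hil (hB k).1
  have hA : ∀ k, opA D (b k) = unitH k := by
    intro k
    rw [← isSolution_iff, coe_unitH, hb]
    exact hB k
  -- As E contains all J-neighbours of S, for k in S restricting a column to `T k` is exactly its
  -- truncation.
  set T : Idx d → Finset (Idx d) := fun k => E.filter fun l => len (l - k) ≤ J
  refine ⟨∑ k ∈ S, r k • b k, ∑ k ∈ S, r k • projH (T k) (b k), ?_, ?_, ?_⟩
  · rw [map_sum]
    ext l
    rw [lp.coeFn_sum, Finset.sum_apply, projH_apply]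
    have : ∀ k ∈ S, (opA D (r k • b k) : Coeff d) l = if k = l then r l else 0 := by
      intro k _
      rw [map_smul, hA, lp.coeFn_smul, Pi.smul_apply, coe_unitH, unitVec, Pi.single_apply]
      by_cases hkl : k = l
      · simp [hkl]
      · simp [hkl, Ne.symm hkl]
    rw [Finset.sum_congr rfl this, Finset.sum_ite_eq']
  · exact MemSpan.sum fun k _ => ((memSpan_projH _ _).mono (Finset.filter_subset _ _)).smul _
  · refine hψ.norm_le fun l => ?_
    rw [← Finset.sum_sub_distrib, lp.coeFn_sum, Finset.sum_apply]
    refine Finset.sum_congr rfl fun k hk => ?_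
    have hbl : b k l = B l k := congrFun (hb k) l
    have hT : (projH (T k) (b k) : Coeff d) l = trunc B J l k := by
      rw [projH_apply, trunc, hbl]
      refine if_congr ?_ rfl rfl
      rw [Finset.mem_filter]
      exact ⟨fun h => h.2, fun h => ⟨(hE l).2 ⟨k, hk, h⟩, h⟩⟩
    rw [← smul_sub, lp.coeFn_smul, Pi.smul_apply, lp.coeFn_sub, Pi.sub_apply, hT, hbl, smul_eq_mul,
      mul_comm]

/-- The error of the predictor is smaller, by a fixed factor `q / 2 < 1`, than the tolerance of the
coarsening step. -/
theorem exists_predictor_factor (D : EllipticData d) :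
    ∃ q : ℝ, 0 ≤ q ∧ q < 2 ∧ ∀ (F u w w' : Hil d) (θ : ℝ) (J : ℕ) (Λ S E : Finset (Idx d)),
      opA D u = F → θ < 1 → 0 < θ → IsEnrichRadius D θ J → MemSpan Λ (w : Coeff d) →
      ‖(F - opA D w) - projH S (F - opA D w)‖ ≤ Real.sqrt (1 - θ ^ 2) * ‖F - opA D w‖ →
      IsEnrich S J E → IsGalerkin D (F : Coeff d) (Λ ∪ E) w' →
      ‖u - w'‖ ≤ q * (1 / D.αlo * Real.sqrt (1 - θ ^ 2) * ‖F - opA D w‖) := by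
  have hlo := αlo_pos D
  have hhi := αhi_pos D
  -- The general estimate has the factor √(2 + 2√(α_*/α^*)), which equals 2 when α_* = α^*; that
  -- case needs its own argument.
  rcases (αlo_le_αhi D).eq_or_lt with h | h
  · refine ⟨1, zero_le_one, one_lt_two, ?_⟩
    intro F u w w' θ J Λ S E hu _ _ _ hw hs hE hw'
    have := predictor_of_eq D h hu hw hs Finset.subset_union_left
      (hE.subset.trans Finset.subset_union_right) hw'
    rwa [one_mul, mul_assoc]
  · set β := (Real.sqrt (D.αhi * D.αlo))⁻¹ with hβ
    have hβ0 : 0 < β := inv_pos.2 (Real.sqrt_pos.2 (by positivity))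
    have hβ2 : D.αhi * D.αlo * β ^ 2 = 1 := by
      rw [hβ, inv_pow, Real.sq_sqrt (by positivity), mul_inv_cancel₀ (by positivity)]
    have hβ1 : D.αlo * β < 1 := by
      refine abs_lt_of_sq_lt_sq' ?_ zero_le_one |>.2
      have : D.αlo * D.αlo * β ^ 2 < D.αhi * D.αlo * β ^ 2 := by gcongr
      nlinarith
    refine ⟨Real.sqrt (2 + 2 * (D.αlo * β)), Real.sqrt_nonneg _, ?_, ?_⟩
    · rw [Real.sqrt_lt' two_pos]
      linarith
    · intro F u w w' θ J Λ S E hu hθ hθ0 hJ hw hs hE hw'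
      obtain ⟨B, ψ, hB, hψ, hJ⟩ := hJ
      obtain ⟨y, z, hy, hz, hyz⟩ := exists_truncated_inverse D hB (hψ.2 J) hE (F - opA D w)
      have hψJ : ψ J ≤ β * Real.sqrt (1 - θ ^ 2) := by
        refine hJ.1.2.trans ?_
        rw [hβ, Real.sqrt_div (by nlinarith), mul_comm D.αlo, div_eq_inv_mul]
      rw [mul_assoc (1 / D.αlo)]
      refine predictor_of_bound D (y := y) (z := z) (by positivity) hβ0.le hβ2 hu
        (hw.mono Finset.subset_union_left) (hz.mono Finset.subset_union_right) ?_ ?_ hw'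
      · rwa [hy]
      · refine hyz.trans ?_
        rw [← mul_assoc]
        exact mul_le_mul hψJ (norm_projH_le _ _) (norm_nonneg _) (by positivity)

theorem IsDorfler.norm_sub_le {d : ℕ} {r : Hil d} {θ : ℝ} {S : Finset (Idx d)} (hθ0 : 0 < θ)
    (hθ : θ < 1) (h : IsDorfler (r : Coeff d) θ S) :
    ‖r - projH S r‖ ≤ Real.sqrt (1 - θ ^ 2) * ‖r‖ := by
  have h1 := h.1
  rw [nrm_coe, nrm_proj] at h1
  have h2 := norm_sq_eq_projH_add S r
  have h3 := pow_le_pow_left₀ (by positivity) h1 2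
  refine abs_le_of_sq_le_sq' ?_ (by positivity) |>.2
  rw [mul_pow, Real.sq_sqrt (by nlinarith)]
  nlinarith

/-- By Pythagoras, capturing the fraction θ of ‖r‖ is the same as leaving at most √(1-θ²)‖r‖, so any
such approximation of r competes with S. -/
theorem IsDorfler.card_le {d : ℕ} {r : Hil d} {θ : ℝ} {S S' : Finset (Idx d)} (hθ0 : 0 < θ)
    (hθ : θ < 1) (h : IsDorfler (r : Coeff d) θ S)
    (h' : ‖r - projH S' r‖ ≤ Real.sqrt (1 - θ ^ 2) * ‖r‖) : S.card ≤ S'.card := by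
  refine h.2 S' ?_
  rw [nrm_coe, nrm_proj]
  have h2 := norm_sq_eq_projH_add S' r
  have h3 := pow_le_pow_left₀ (norm_nonneg _) h' 2
  rw [mul_pow, Real.sq_sqrt (by nlinarith)] at h3
  refine abs_le_of_sq_le_sq' ?_ (norm_nonneg _) |>.2
  nlinarith

/-! ### The corrector step -/

/-- The map v ↦ v - P_Y v is a contraction, so replacing u by w costs at most qε and Y passes the
tolerance 2ε. Only subsets of Λ' compete, but w vanishes off Λ', so Y may be intersected with it. -/
theorem IsCoarse.card_le {d : ℕ} {u w : Hil d} {Λ' Λ Y : Finset (Idx d)} {q ε : ℝ}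
    (h : IsCoarse Λ' (w : Coeff d) ε Λ) (hw : MemSpan Λ' (w : Coeff d))
    (hu : ‖u - w‖ ≤ q * ε) (hY : ‖u - projH Y u‖ ≤ (2 - q) * ε) : Λ.card ≤ Y.card := by
  classical
  refine (h.2.2 (Y ∩ Λ') Finset.inter_subset_right ?_).trans
    (Finset.card_le_card Finset.inter_subset_left)
  have h1 : projH (Y ∩ Λ') w = projH Y w := by
    ext k
    rw [projH_apply, projH_apply]
    by_cases hk : k ∈ Λ'
    · simp [hk]
    · simp [hk, hw k hk]
  rw [nrm_sub_proj, h1]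
  have h2 : w - projH Y w = (u - projH Y u) - ((u - w) - projH Y (u - w)) := by
    rw [map_sub]; abel
  rw [h2]
  have h3 := norm_sub_projH_le Y (u - w)
  linarith [norm_sub_le (u - projH Y u) ((u - w) - projH Y (u - w))]

theorem IsCoarse.norm_sub_le (D : EllipticData d) {F u w w' : Hil d} {Λ' Λ : Finset (Idx d)}
    {q ε : ℝ} (hu : opA D u = F) (h : IsCoarse Λ' (w : Coeff d) ε Λ) (hw : ‖u - w‖ ≤ q * ε)
    (hw' : IsGalerkin D (F : Coeff d) Λ w') :
    ‖u - w'‖ ≤ D.αhi / D.αlo * ((q + 2) * ε) := by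
  refine (norm_sub_galerkin_le D hu hw' (memSpan_projH Λ w)).trans ?_
  have h1 := h.2.1
  rw [nrm_sub_proj] at h1
  have h2 : u - projH Λ w = (u - w) + (w - projH Λ w) := by abel
  have hlo := αlo_pos D
  have hhi := αhi_pos D
  rw [h2]
  gcongr
  linarith [norm_add_le (u - w) (w - projH Λ w)]

/-! ### Neighbourhoods in the lattice -/

theorem abs_coord_le_len (k : Idx d) (j : Fin d) : |(k j : ℝ)| ≤ len k := by
  rw [len, ← Real.sqrt_sq_eq_abs]
  exact Real.sqrt_le_sqrt (Finset.single_le_sum (f := fun j => (k j : ℝ) ^ 2)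
    (fun _ _ => sq_nonneg _) (Finset.mem_univ j))

theorem len_nonneg (k : Idx d) : 0 ≤ len k := Real.sqrt_nonneg _

/-- The indices within the distance `R` of `S` in the maximum norm. -/
def nbhd (S : Finset (Idx d)) (R : ℕ) : Finset (Idx d) :=
  S.biUnion fun l => Finset.Icc (fun j => l j - R) fun j => l j + R

theorem mem_nbhd {S : Finset (Idx d)} {R : ℕ} {k : Idx d} :
    k ∈ nbhd S R ↔ ∃ l ∈ S, ∀ j, |k j - l j| ≤ R := by
  simp only [nbhd, Finset.mem_biUnion, Finset.mem_Icc, Pi.le_def, ← forall_and]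
  refine exists_congr fun l => and_congr_right fun _ => forall_congr' fun j => ?_
  rw [abs_le]
  constructor <;> rintro ⟨h1, h2⟩ <;> constructor <;> linarith

theorem card_nbhd_le (S : Finset (Idx d)) (R : ℕ) : (nbhd S R).card ≤ S.card * (2 * R + 1) ^ d := by
  refine Finset.card_biUnion_le_card_mul _ _ _ fun l _ => ?_
  rw [Pi.card_Icc]
  have : ∀ j : Fin d, (Finset.Icc (l j - R) (l j + R)).card = 2 * R + 1 := by
    intro j
    rw [Int.card_Icc]
    omega
  simp [this]

theorem IsEnrich.card_le {S E : Finset (Idx d)} {J : ℕ} (h : IsEnrich S J E) :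
    E.card ≤ S.card * (2 * J + 1) ^ d := by
  refine (Finset.card_le_card fun k hk => ?_).trans (card_nbhd_le S J)
  obtain ⟨l, hl, hkl⟩ := (h k).1 hk
  refine mem_nbhd.2 ⟨l, hl, fun j => ?_⟩
  have := (abs_coord_le_len (k - l) j).trans hkl
  exact_mod_cast this

/-- The indices of maximum norm at most `J`. -/
def box (d J : ℕ) : Finset (Idx d) := nbhd {0} J

theorem mem_box {J : ℕ} {k : Idx d} : k ∈ box d J ↔ ∀ j, |k j| ≤ J := by
  simp [box, mem_nbhd]

theorem lt_len_of_notMem_box {J : ℕ} {k : Idx d} (h : k ∉ box d J) : (J : ℝ) < len k := by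
  rw [mem_box] at h
  push Not at h
  obtain ⟨j, hj⟩ := h
  refine lt_of_lt_of_le ?_ (abs_coord_le_len k j)
  exact_mod_cast hj

theorem summable_exp_neg_abs {a : ℝ} (ha : 0 < a) :
    Summable fun n : ℤ => Real.exp (-a * |(n : ℝ)|) := by
  have h : Summable fun n : ℕ => Real.exp (-a * n) := by
    have := Real.summable_exp_nat_mul_iff.2 (neg_lt_zero.2 ha)
    simpa [mul_comm] using this
  refine Summable.of_nat_of_neg ?_ ?_ <;> simpa using h

/-- Domination by a product of one-dimensional geometric series, since ∑|k_j| ≤ d |k|. -/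
theorem summable_exp_neg_len (d : ℕ) {a : ℝ} (ha : 0 < a) :
    Summable fun k : Idx d => Real.exp (-a * len k) := by
  classical
  set b := a / (d + 1) with hb
  have hb0 : 0 < b := by positivity
  have hs := summable_exp_neg_abs hb0
  have hle : ∀ k : Idx d, Real.exp (-a * len k) ≤ ∏ j, Real.exp (-b * |(k j : ℝ)|) := by
    intro k
    rw [← Real.exp_sum, ← Finset.mul_sum]
    refine Real.exp_le_exp.2 ?_
    have h1 : ∑ j, |(k j : ℝ)| ≤ d * len k := by
      refine (Finset.sum_le_sum fun j _ => abs_coord_le_len k j).trans_eq ?_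
      simp
    have h2 : a = b * (d + 1) := by rw [hb]; field_simp
    have h3 := len_nonneg k
    nlinarith
  refine Summable.of_nonneg_of_le (fun _ => (Real.exp_pos _).le) hle ?_
  refine summable_of_sum_le (c := (∑' n : ℤ, Real.exp (-b * |(n : ℝ)|)) ^ d)
    (fun k => Finset.prod_nonneg fun _ _ => (Real.exp_pos _).le) fun s => ?_
  have hsub : s ⊆ Fintype.piFinset fun j => s.image fun k => k j := fun k hk =>
    Fintype.mem_piFinset.2 fun j => Finset.mem_image_of_mem _ hk
  refine (Finset.sum_le_sum_of_subset_of_nonneg hsub fun _ _ _ =>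
    Finset.prod_nonneg fun _ _ => (Real.exp_pos _).le).trans ?_
  rw [← Finset.prod_univ_sum (fun j => s.image fun k => k j)
    fun (_ : Fin d) (n : ℤ) => Real.exp (-b * |(n : ℝ)|)]
  refine (Finset.prod_le_prod (fun _ _ => Finset.sum_nonneg fun _ _ => (Real.exp_pos _).le)
    fun j _ => hs.sum_le_tsum _ fun _ _ => (Real.exp_pos _).le).trans_eq ?_
  simp

/-! ### Banded approximations of the stiffness operator -/

/-- A row of A, indexed by the difference m of the indices: this splits A into its diagonals, each a
weighted shift. -/
theorem hasSum_opA_apply (D : EllipticData d) (v : Hil d) (k : Idx d) :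
    HasSum (fun m => stiffness D k (k - m) * v (k - m)) (opA D v k) := by
  have h1 := lp.hasSum_inner (𝕜 := ℂ) (opA D (unitH k)) v
  rw [← inner_opA_symm, inner_unitH_left] at h1
  have h2 : ∀ l, inner ℂ (opA D (unitH k) l) (v l) = stiffness D k l * v l := by
    intro l
    rw [stiffness_eq, ← inner_unitH_left k (opA D (unitH l)), inner_opA_symm,
      ← inner_conj_symm (opA D (unitH k)) (unitH l), inner_unitH_left, RCLike.inner_apply, mul_comm]
  simp_rw [h2] at h1
  exact ((Equiv.subLeft k).hasSum_iff (f := fun l => stiffness D k l * v l)).2 h1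

/-- The m-th diagonal has norm at most c e^{-η_L|m|}, so A is the norm-convergent sum of its
diagonals, and T keeps those in a box. Half of the decay rate is spent on summing the tail, the
other half yields the factor e^{-η_L J/2}. -/
theorem exists_banded (D : EllipticData d) {ηL : ℝ} (hη : 0 < ηL)
    (h : ExpMatrix ηL (stiffness D)) :
    ∃ H : ℝ, 0 < H ∧ ∀ J : ℕ, ∃ T : Hil d →L[ℂ] Hil d,
      (∀ v, ‖opA D v - T v‖ ≤ H * Real.exp (-(ηL / 2) * J) * ‖v‖) ∧
      ∀ (S : Finset (Idx d)) (R : ℕ) (v : Hil d), MemSpan (nbhd S R) (v : Coeff d) →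
        MemSpan (nbhd S (R + J)) (T v : Coeff d) := by
  obtain ⟨c, hc, hB⟩ := h
  have hbd : ∀ m k : Idx d, ‖stiffness D k (k - m)‖ ≤ c * Real.exp (-ηL * len m) := by
    intro m k
    have := hB k (k - m)
    rwa [sub_sub_cancel] at this
  set W : Idx d → Hil d →L[ℂ] Hil d := fun m =>
    wshift (fun k => stiffness D k (k - m)) (c * Real.exp (-ηL * len m)) (hbd m) m with hW
  have hWn : ∀ m, ‖W m‖ ≤ c * Real.exp (-ηL * len m) := fun m => norm_wshift_le _ _ _ _
  have hWs : Summable W := Summable.of_norm_bounded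
    ((summable_exp_neg_len d hη).mul_left c) hWn
  have hWA : HasSum W (opA D) := by
    have h1 : ∑' m, W m = opA D := by
      ext v k
      have h2 := hWs.hasSum.mapL ((lp.evalCLM ℂ (fun _ : Idx d => ℂ) 2 k) ∘L
        (ContinuousLinearMap.apply ℂ (Hil d) v))
      exact h2.unique (hasSum_opA_apply D v k)
    rw [← h1]
    exact hWs.hasSum
  have hs2 := summable_exp_neg_len d (half_pos hη)
  set H := ∑' m : Idx d, c * Real.exp (-(ηL / 2) * len m) with hH
  have hH0 : 0 < H := (hs2.mul_left c).tsum_pos (fun _ => by positivity) 0 (by positivity)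
  refine ⟨H, hH0, fun J =>
    ⟨∑ m ∈ box d J, W m, fun v => ?_, fun S R v hv k hk => ?_⟩⟩
  · have h1 : HasSum (fun m => W m - if m ∈ box d J then W m else 0)
        (opA D - ∑ m ∈ box d J, W m) := by
      refine hWA.sub ?_
      have h2 : HasSum (fun m => if m ∈ box d J then W m else 0)
          (∑ m ∈ box d J, if m ∈ box d J then W m else 0) :=
        hasSum_sum_of_ne_finset_zero fun m hm => if_neg hm
      rwa [Finset.sum_congr rfl fun m hm => if_pos hm] at h2
    have h2 : ‖opA D - ∑ m ∈ box d J, W m‖ ≤ H * Real.exp (-(ηL / 2) * J) := by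
      rw [← h1.tsum_eq]
      refine tsum_of_norm_bounded ((hs2.mul_left c).hasSum.mul_right _) fun m => ?_
      split_ifs with hm
      · rw [sub_self, norm_zero]
        positivity
      · rw [sub_zero]
        refine (hWn m).trans ?_
        rw [mul_assoc, ← Real.exp_add]
        have := lt_len_of_notMem_box hm
        gcongr
        nlinarith
    rw [← sub_apply]
    exact ContinuousLinearMap.le_of_opNorm_le _ h2 v
  · rw [sum_apply, lp.coeFn_sum, Finset.sum_apply]
    refine Finset.sum_eq_zero fun m hm => ?_
    rw [hW, wshift_apply, hv (k - m), mul_zero]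
    intro hkm
    refine hk ?_
    obtain ⟨l, hl, hkl⟩ := mem_nbhd.1 hkm
    refine mem_nbhd.2 ⟨l, hl, fun j => ?_⟩
    have h1 := hkl j
    have h2 := mem_box.1 hm j
    have h3 : k j - l j = ((k - m) j - l j) + m j := by
      rw [Pi.sub_apply]; ring
    rw [h3]
    push_cast
    exact (abs_add_le _ _).trans (add_le_add h1 h2)

/-! ### Banded approximation of the residuals of Galerkin solutions -/

/-- Expand ‖e - ωAe‖² = ‖e‖² - 2ω Re⟨e, Ae⟩ + ω²‖Ae‖²; the choice ω = α_*/(α^*)² leaves the factor 1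
- (α_*/α^*)². -/
theorem exists_contraction (D : EllipticData d) :
    ∃ ω ρ : ℝ, 0 < ω ∧ 0 ≤ ρ ∧ ρ < 1 ∧ ∀ e : Hil d, ‖e - (ω : ℂ) • opA D e‖ ≤ ρ * ‖e‖ := by
  have hlo := αlo_pos D
  have hhi := αhi_pos D
  have hle := αlo_le_αhi D
  have h1 : (D.αlo / D.αhi) ^ 2 ≤ 1 := by
    rw [div_pow, div_le_one (by positivity)]
    gcongr
  have h2 : 0 < (D.αlo / D.αhi) ^ 2 := by positivity
  refine ⟨D.αlo / D.αhi ^ 2, Real.sqrt (1 - (D.αlo / D.αhi) ^ 2), by positivity,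
    Real.sqrt_nonneg _, ?_, fun e => ?_⟩
  · rw [Real.sqrt_lt' one_pos]
    linarith
  · set ω := D.αlo / D.αhi ^ 2 with hω
    have hω0 : 0 < ω := by positivity
    refine abs_le_of_sq_le_sq' ?_ (by positivity) |>.2
    rw [mul_pow, Real.sq_sqrt (by linarith), norm_sub_sq (𝕜 := ℂ), inner_smul_right, norm_smul,
      Complex.norm_real, Real.norm_of_nonneg hω0.le, RCLike.re_eq_complex_re, Complex.re_ofReal_mul]
    have h3 := αlo_mul_le D e
    have h4 : (ω * ‖opA D e‖) ^ 2 ≤ (ω * (D.αhi * ‖e‖)) ^ 2 := by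
      gcongr
      exact norm_opA_apply_le D e
    have h5 : ω * (D.αlo * ‖e‖ ^ 2) ≤ ω * (inner ℂ e (opA D e)).re := by gcongr
    have h6 : (ω * (D.αhi * ‖e‖)) ^ 2 = (D.αlo / D.αhi) ^ 2 * ‖e‖ ^ 2 := by
      rw [hω]; field_simp
    have h7 : ω * (D.αlo * ‖e‖ ^ 2) = (D.αlo / D.αhi) ^ 2 * ‖e‖ ^ 2 := by
      rw [hω]; field_simp
    nlinarith

theorem projH_residual_eq_zero (D : EllipticData d) {F w : Hil d} {Λ : Finset (Idx d)}
    (hw : IsGalerkin D (F : Coeff d) Λ w) : projH Λ (F - opA D w) = 0 := by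
  rw [isGalerkin_iff] at hw
  rw [← inner_self_eq_zero (𝕜 := ℂ), inner_projH_left _ (memSpan_projH _ _), inner_sub_right,
    hw.2 _ (memSpan_projH _ _), sub_self]

theorem norm_sub_projH_le_of_memSpan {Λ : Finset (Idx d)} {v y : Hil d}
    (hy : MemSpan Λ (y : Coeff d)) : ‖v - projH Λ v‖ ≤ ‖v - y‖ := by
  have h : v - projH Λ v = (v - y) - projH Λ (v - y) := by
    rw [map_sub, projH_eq_self hy]; abel
  rw [h]
  exact norm_sub_projH_le _ _

/-- Richardson iteration with a banded operator approximates Galerkin solutions. -/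
theorem exists_banded_iterate (D : EllipticData d) {ω ρ τ : ℝ} (hω : 0 < ω)
    (hρ0 : 0 ≤ ρ) (hρ : ρ < 1) (hcon : ∀ e : Hil d, ‖e - (ω : ℂ) • opA D e‖ ≤ ρ * ‖e‖)
    (hτ0 : 0 ≤ τ) (hτ : ω * τ ≤ (1 - ρ) / 2) {T : Hil d →L[ℂ] Hil d} {J : ℕ}
    (hT : ∀ v, ‖opA D v - T v‖ ≤ τ * ‖v‖)
    (hTs : ∀ (S : Finset (Idx d)) (R : ℕ) (v : Hil d), MemSpan (nbhd S R) (v : Coeff d) →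
        MemSpan (nbhd S (R + J)) (T v : Coeff d))
    {F u w x : Hil d} {Λ S : Finset (Idx d)} (hu : opA D u = F)
    (hw : IsGalerkin D (F : Coeff d) Λ w) (hx : MemSpan S (x : Coeff d)) (n : ℕ) :
    ∃ z : Hil d, MemSpan Λ (z : Coeff d) ∧ MemSpan (nbhd S (n * J)) (z : Coeff d) ∧
      ‖w - z‖ ≤ ((1 + ρ) / 2) ^ n * ‖w‖ +
        2 / (1 - ρ) * (ω * (τ * (‖u - x‖ + ‖u - w‖) + D.αhi * ‖u - x‖)) := by
  have hhi := αhi_pos D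
  set G := ω * (τ * (‖u - x‖ + ‖u - w‖) + D.αhi * ‖u - x‖) with hG
  have hG0 : 0 ≤ G := by positivity
  have h1ρ : 0 < 1 - ρ := by linarith
  induction n with
  | zero =>
    refine ⟨0, MemSpan.zero _, MemSpan.zero _, ?_⟩
    rw [sub_zero, pow_zero, one_mul]
    have : 0 ≤ 2 / (1 - ρ) * G := by positivity
    linarith
  | succ n ih =>
    obtain ⟨z, hz1, hz2, hz3⟩ := ih
    have hsub : ∀ {R R' : ℕ}, R ≤ R' → nbhd S R ⊆ nbhd S R' := by
      intro R R' hR k hk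
      obtain ⟨l, hl, h⟩ := mem_nbhd.1 hk
      exact mem_nbhd.2 ⟨l, hl, fun j => (h j).trans (by exact_mod_cast hR)⟩
    have hSn : S ⊆ nbhd S (n * J) := fun k hk => mem_nbhd.2 ⟨k, hk, fun j => by
      rw [sub_self, abs_zero]; positivity⟩
    have hTx : MemSpan (nbhd S ((n + 1) * J)) (T (x - z) : Coeff d) := by
      rw [add_one_mul]
      exact hTs S _ _ ((hx.mono hSn).sub hz2)
    have hP : MemSpan (nbhd S ((n + 1) * J)) (projH Λ (T (x - z)) : Coeff d) := by
      intro k hk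
      rw [projH_apply, hTx k hk, ite_self]
    refine ⟨z + (ω : ℂ) • projH Λ (T (x - z)), hz1.add ((memSpan_projH _ _).smul _),
      (hz2.mono (hsub (by rw [add_one_mul]; exact Nat.le_add_right _ _))).add (hP.smul _), ?_⟩
    set e := w - z with he
    have heΛ : projH Λ e = e := projH_eq_self (hw.1.sub hz1)
    -- All perturbations at once: the banding error, and u replaced by x. The exact residual
    -- disappears because P_Λ annihilates it.
    set g := opA D (x - z) - T (x - z) + opA D (u - x) with hg
    have h1 : w - (z + (ω : ℂ) • projH Λ (T (x - z))) =
        projH Λ (e - (ω : ℂ) • opA D e) + (ω : ℂ) • projH Λ g := by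
      have h2 : T (x - z) = opA D e + (F - opA D w) - g := by
        rw [hg, he, ← hu]
        simp only [map_sub]
        abel
      rw [h2, map_sub (projH Λ), map_add (projH Λ), projH_residual_eq_zero D hw, add_zero,
        map_sub (projH Λ), map_smul (projH Λ), heΛ, smul_sub, he]
      abel
    have h3 : ‖projH Λ (e - (ω : ℂ) • opA D e)‖ ≤ ρ * ‖e‖ := (norm_projH_le _ _).trans (hcon e)
    have h4 : ‖x - z‖ ≤ ‖u - x‖ + ‖u - w‖ + ‖e‖ := by
      have : x - z = (u - w) - (u - x) + e := by rw [he]; abel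
      rw [this]
      linarith [norm_add_le ((u - w) - (u - x)) e, norm_sub_le (u - w) (u - x)]
    have h5 : ‖g‖ ≤ τ * (‖u - x‖ + ‖u - w‖ + ‖e‖) + D.αhi * ‖u - x‖ :=
      (norm_add_le _ _).trans (add_le_add ((hT _).trans (by gcongr)) (norm_opA_apply_le D _))
    have h6 : ‖(ω : ℂ) • projH Λ g‖ ≤ ω * ‖g‖ := by
      rw [norm_smul, Complex.norm_real, Real.norm_of_nonneg hω.le]
      gcongr
      exact norm_projH_le _ _
    rw [h1]
    have h7 : ‖projH Λ (e - (ω : ℂ) • opA D e) + (ω : ℂ) • projH Λ g‖ ≤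
        (1 + ρ) / 2 * ‖e‖ + G := by
      have h8 : ω * ‖g‖ ≤ G + ω * τ * ‖e‖ := by
        refine (mul_le_mul_of_nonneg_left h5 hω.le).trans_eq ?_
        rw [hG]; ring
      -- The part of the banding error proportional to e worsens the contraction only from ρ to
      -- (1+ρ)/2; 2/(1-ρ) is then the sum of the geometric series.
      have h9 : ω * τ * ‖e‖ ≤ (1 - ρ) / 2 * ‖e‖ := by gcongr
      linarith [norm_add_le (projH Λ (e - (ω : ℂ) • opA D e)) ((ω : ℂ) • projH Λ g)]
    refine h7.trans ?_
    have h10 : (1 + ρ) / 2 * ‖e‖ ≤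
        (1 + ρ) / 2 * (((1 + ρ) / 2) ^ n * ‖w‖ + 2 / (1 - ρ) * G) := by
      gcongr
    have h11 : (1 + ρ) / 2 * (2 / (1 - ρ) * G) + G = 2 / (1 - ρ) * G := by
      field_simp
      ring
    rw [pow_succ]
    linarith

/-- Residuals of Galerkin solutions are approximated by families supported near the support of an
approximation of the exact solution. -/
theorem exists_residual_approx (D : EllipticData d) :
    ∃ ρ τ₀ K : ℝ, 0 < ρ ∧ ρ < 1 ∧ 0 < τ₀ ∧ 0 < K ∧
      ∀ (τ : ℝ) (T : Hil d →L[ℂ] Hil d) (J : ℕ), 0 ≤ τ → τ ≤ τ₀ →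
      (∀ v, ‖opA D v - T v‖ ≤ τ * ‖v‖) →
      (∀ (S : Finset (Idx d)) (R : ℕ) (v : Hil d), MemSpan (nbhd S R) (v : Coeff d) →
        MemSpan (nbhd S (R + J)) (T v : Coeff d)) →
      ∀ (F u w : Hil d) (Λ S : Finset (Idx d)) (n : ℕ), opA D u = F →
      IsGalerkin D (F : Coeff d) Λ w →
      ‖(F - opA D w) - projH (nbhd S ((n + 1) * J)) (F - opA D w)‖ ≤
        K * (ρ ^ n * ‖u‖ + τ * ‖u‖ + ‖u - projH S u‖) := by
  obtain ⟨ω, ρ, hω, hρ0, hρ, hcon⟩ := exists_contraction D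
  have hlo := αlo_pos D
  have hhi := αhi_pos D
  have h1ρ : 0 < 1 - ρ := by linarith
  set M := D.αhi
  set q := D.αhi / D.αlo with hq
  have hq0 : 0 < q := by positivity
  set τ₀ := (1 - ρ) / 2 / ω with hτ₀
  have hτ₀0 : 0 < τ₀ := by positivity
  set K₂ := 2 / (1 - ρ) * (ω * (1 + q + M)) with hK₂
  refine ⟨(1 + ρ) / 2, τ₀, (1 + q + M) + (M + τ₀) * (1 + q + K₂), by linarith, by linarith, hτ₀0,
    by positivity, ?_⟩
  intro τ T J hτ0 hτ hT hTs F u w Λ S n hu hw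
  have hωτ : ω * τ ≤ (1 - ρ) / 2 := by
    rw [hτ₀, le_div_iff₀ hω] at hτ
    linarith
  set x := projH S u with hx
  have hxS : MemSpan S (x : Coeff d) := memSpan_projH S u
  obtain ⟨z, -, hz2, hz3⟩ := exists_banded_iterate D hω hρ0 hρ hcon hτ0 hωτ hT hTs hu hw hxS n
  set E := ‖u - x‖ with hE
  have hEu : E ≤ ‖u‖ := norm_sub_projH_le S u
  have huw : ‖u - w‖ ≤ q * ‖u‖ := norm_sub_galerkin_le_norm D hu hw
  have hwn : ‖w‖ ≤ (1 + q) * ‖u‖ := by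
    have : w = u - (u - w) := by abel
    rw [this]
    linarith [norm_sub_le u (u - w)]
  set b := τ * ‖u‖ + E with hb
  have hE0 : 0 ≤ E := norm_nonneg _
  have hu0 : 0 ≤ ‖u‖ := norm_nonneg _
  have hb0 : 0 ≤ b := by positivity
  have hEb : E ≤ b := by
    have : 0 ≤ τ * ‖u‖ := by positivity
    linarith
  have hτb : τ * ‖u‖ ≤ b := by linarith
  have h1 : τ * (E + ‖u - w‖) ≤ (1 + q) * b := by
    calc τ * (E + ‖u - w‖) ≤ τ * (‖u‖ + q * ‖u‖) := by gcongr
      _ = (1 + q) * (τ * ‖u‖) := by ring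
      _ ≤ (1 + q) * b := by gcongr
  have h2 : M * E ≤ M * b := by gcongr
  set r₀ := ((1 + ρ) / 2) ^ n with hr₀
  have hr₀0 : 0 ≤ r₀ := by positivity
  have he : ‖w - z‖ ≤ (1 + q) * (r₀ * ‖u‖) + K₂ * b := by
    refine hz3.trans ?_
    have e1 : r₀ * ‖w‖ ≤ (1 + q) * (r₀ * ‖u‖) := by
      calc r₀ * ‖w‖ ≤ r₀ * ((1 + q) * ‖u‖) := by gcongr
        _ = _ := by ring
    have e2 : 2 / (1 - ρ) * (ω * (τ * (E + ‖u - w‖) + M * E)) ≤ K₂ * b := by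
      calc 2 / (1 - ρ) * (ω * (τ * (E + ‖u - w‖) + M * E))
          ≤ 2 / (1 - ρ) * (ω * ((1 + q) * b + M * b)) := by gcongr
        _ = K₂ * b := by rw [hK₂]; ring
    exact add_le_add e1 e2
  have hS0 : S ⊆ nbhd S (n * J) := fun k hk => mem_nbhd.2 ⟨k, hk, fun j => by
    rw [sub_self, abs_zero]; positivity⟩
  have hTx : MemSpan (nbhd S ((n + 1) * J)) (T (x - z) : Coeff d) := by
    rw [add_one_mul]
    exact hTs S _ _ ((hxS.mono hS0).sub hz2)
  refine (norm_sub_projH_le_of_memSpan hTx).trans ?_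
  -- The residual is A(u - w), so T(x - z) is its approximant; it spreads the support by one further
  -- J.
  have h3 : F - opA D w - T (x - z) =
      opA D (u - x) - opA D (w - z) + (opA D (x - z) - T (x - z)) := by
    rw [← hu]
    simp only [map_sub]
    abel
  have h4 : ‖x - z‖ ≤ E + ‖u - w‖ + ‖w - z‖ := by
    have : x - z = (u - w) - (u - x) + (w - z) := by abel
    rw [this]
    linarith [norm_add_le ((u - w) - (u - x)) (w - z), norm_sub_le (u - w) (u - x)]
  have h5 : ‖F - opA D w - T (x - z)‖ ≤
      M * E + M * ‖w - z‖ + τ * (E + ‖u - w‖ + ‖w - z‖) := by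
    rw [h3]
    refine (norm_add_le _ _).trans (add_le_add ((norm_sub_le _ _).trans (add_le_add
      (norm_opA_apply_le D _) (norm_opA_apply_le D _))) ((hT _).trans (by gcongr)))
  have h6 : τ * ‖w - z‖ ≤ τ₀ * ‖w - z‖ := by gcongr
  have h7 : (M + τ₀) * ‖w - z‖ ≤ (M + τ₀) * ((1 + q) * (r₀ * ‖u‖) + K₂ * b) := by gcongr
  have h8 : 0 ≤ r₀ * ‖u‖ := by positivity
  have h9 : (1 + q + M) * b + (M + τ₀) * ((1 + q) * (r₀ * ‖u‖) + K₂ * b) ≤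
      ((1 + q + M) + (M + τ₀) * (1 + q + K₂)) * (r₀ * ‖u‖ + b) := by
    have hK₂0 : 0 ≤ K₂ := by positivity
    have e1 : 0 ≤ (1 + q + M) * (r₀ * ‖u‖) := by positivity
    have e2 : 0 ≤ (M + τ₀) * (K₂ * (r₀ * ‖u‖)) := by positivity
    have e3 : 0 ≤ (M + τ₀) * ((1 + q) * b) := by positivity
    linarith
  rw [add_assoc (r₀ * ‖u‖)]
  refine le_trans ?_ h9
  linarith

/-! ### Sparsity of residuals -/

theorem bestErr_antitone (hd : 1 ≤ d) (v : Hil d) {N N' : ℕ} (h : N ≤ N') :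
    bestErr (v : Coeff d) N' ≤ bestErr (v : Coeff d) N := by
  refine le_of_forall_gt fun ε hε => ?_
  obtain ⟨Λ, h1, h2⟩ := exists_card_eq_norm_sub_lt hd v N hε
  exact (bestErr_le hd v (h1.trans_le h)).trans_lt h2

/-- Exponential decay of the best errors along `C₀ n^p` gives exponential decay of all of them. -/
theorem bestErr_le_of_subsequence (hd : 1 ≤ d) {v : Hil d} {p C₀ : ℕ} {γ G : ℝ} (hp : 1 ≤ p)
    (hC₀ : 1 ≤ C₀) (hγ : 0 < γ) (hv : ‖v‖ ≤ G)
    (h : ∀ n : ℕ, 1 ≤ n → bestErr (v : Coeff d) (C₀ * n ^ p) ≤ G * Real.exp (-γ * n)) (M : ℕ) :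
    bestErr (v : Coeff d) M ≤
      G * Real.exp γ * Real.exp (-γ * ((M : ℝ) / C₀) ^ (1 / (p : ℝ))) := by
  have hG : 0 ≤ G := (norm_nonneg _).trans hv
  set x := ((M : ℝ) / C₀) ^ (1 / (p : ℝ)) with hx
  have hx0 : 0 ≤ x := by positivity
  -- The last n with C₀ n^p ≤ M. Rounding down costs the factor e^γ; n = 0 is covered by ‖v‖ ≤ G.
  set n := ⌊x⌋₊ with hn
  have hnx : x < n + 1 := Nat.lt_floor_add_one x
  have hC₀' : (0 : ℝ) < C₀ := by exact_mod_cast hC₀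
  have hmain : bestErr (v : Coeff d) M ≤ G * Real.exp (-γ * n) := by
    rcases Nat.eq_zero_or_pos n with h0 | h0
    · rw [h0, Nat.cast_zero, mul_zero, Real.exp_zero, mul_one]
      refine le_trans ?_ hv
      rw [← bestErr_zero]
      exact bestErr_antitone hd v (Nat.zero_le _)
    · refine (bestErr_antitone hd v ?_).trans (h n h0)
      have h1 : (n : ℝ) ≤ x := Nat.floor_le hx0
      have h2 : (n : ℝ) ^ p ≤ M / C₀ := by
        refine (pow_le_pow_left₀ (by positivity) h1 p).trans_eq ?_
        rw [hx, one_div, Real.rpow_inv_natCast_pow (by positivity) (by omega)]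
      rw [le_div_iff₀ hC₀', mul_comm] at h2
      exact_mod_cast h2
  refine hmain.trans ?_
  rw [mul_assoc, ← Real.exp_add]
  gcongr
  nlinarith

/-- Uniform exponential decay of the best errors of the residuals along `C₀ n^p`. -/
theorem exists_residual_decay (hd : 1 ≤ d) (D : EllipticData d) {η t ηL : ℝ} (hη : 0 < η)
    (ht : 0 < t) (hηL : 0 < ηL) (hExp : ExpMatrix ηL (stiffness D)) :
    ∃ (p C₀ : ℕ) (γ K : ℝ), (d : ℝ) / t ≤ p ∧ 1 ≤ p ∧ 1 ≤ C₀ ∧ 0 < γ ∧ 0 < K ∧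
      ∀ (F u w : Hil d) (Λ : Finset (Idx d)) (U : ℝ), opA D u = F →
        MemExpClass η t (u : Coeff d) → expNorm η t (u : Coeff d) < U →
        IsGalerkin D (F : Coeff d) Λ w → ∀ n : ℕ, 1 ≤ n →
        bestErr ((F - opA D w : Hil d) : Coeff d) (C₀ * n ^ p) ≤ K * U * Real.exp (-γ * n) := by
  obtain ⟨H, hH, hband⟩ := exists_banded D hηL hExp
  obtain ⟨ρ, τ₀, K, hρ0, hρ, hτ₀, hK, happ⟩ := exists_residual_approx D
  have hd' : (0 : ℝ) < d := by exact_mod_cast hd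
  have hω := ballVol_pos d
  set q := ⌈(d : ℝ) / t⌉₊ with hq
  have hqt : (d : ℝ) / t ≤ q := Nat.le_ceil _
  -- A minimal bandwidth, so that the perturbed Richardson iteration still contracts.
  obtain ⟨J₀, hJ₀⟩ : ∃ J₀ : ℕ, H * Real.exp (-(ηL / 2) * J₀) ≤ τ₀ := by
    obtain ⟨J₀, hJ₀⟩ := exists_nat_ge (-(Real.log (τ₀ / H)) / (ηL / 2))
    refine ⟨J₀, ?_⟩
    rw [mul_comm, ← le_div_iff₀ hH, ← Real.le_log_iff_exp_le (by positivity)]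
    rw [div_le_iff₀ (by positivity)] at hJ₀
    linarith
  set γ₃ := η * ballVol d ^ (-(t / d)) with hγ₃
  have hγ₃0 : 0 < γ₃ := by positivity
  set γ₁ := -Real.log ρ with hγ₁
  have hγ₁0 : 0 < γ₁ := neg_pos.2 (Real.log_neg hρ0 hρ)
  set γ := min γ₁ (min (ηL / 2) γ₃) with hγ
  have hγ0 : 0 < γ := lt_min hγ₁0 (lt_min (by positivity) hγ₃0)
  -- From |S| = n^q and 2(n+1)(J₀+n) + 1 ≤ (4J₀+5) n², the latter raised to the power d.
  refine ⟨q + 2 * d, (4 * J₀ + 5) ^ d, γ, K * (1 + τ₀ + H + 1), ?_, by omega,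
    Nat.one_le_pow _ _ (by omega), hγ0, by positivity, ?_⟩
  · push_cast
    linarith
  intro F u w Λ U hu hA hU hw n hn
  have huA := norm_le_expNorm hd ht hA
  have hU0 : 0 < U := ((norm_nonneg u).trans huA).trans_lt hU
  have hn' : (1 : ℝ) ≤ n := by exact_mod_cast hn
  have hE : bestErr (u : Coeff d) (n ^ q) < U * Real.exp (-γ * n) := by
    have h1 := expRatio_le_expNorm hA (n ^ q)
    rw [expRatio] at h1
    have h2 : (n : ℝ) ≤ ((n ^ q : ℕ) : ℝ) ^ (t / d) := by
      push_cast
      rw [← Real.rpow_natCast_mul (by positivity)]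
      refine Real.self_le_rpow_of_one_le hn' ?_
      rw [div_le_iff₀ ht] at hqt
      rw [← mul_div_assoc, le_div_iff₀ hd']
      linarith
    have h3 : γ * n ≤ γ₃ * ((n ^ q : ℕ) : ℝ) ^ (t / d) := by
      have : γ ≤ γ₃ := (min_le_right _ _).trans (min_le_right _ _)
      gcongr
    have h4 : bestErr (u : Coeff d) (n ^ q) * Real.exp (γ * n) < U := by
      refine lt_of_le_of_lt (le_trans ?_ h1) hU
      have := bestErr_nonneg (u : Coeff d) (n ^ q)
      gcongr
    rw [neg_mul, Real.exp_neg, ← div_eq_mul_inv, lt_div_iff₀ (Real.exp_pos _)]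
    exact h4
  obtain ⟨S, hS, hSu⟩ := exists_card_eq_norm_sub_lt hd u _ hE
  -- Bandwidth and number of iterations grow together, so all error contributions decay like
  -- e^{-γn}.
  set J := J₀ + n with hJ
  obtain ⟨T, hT, hTs⟩ := hband J
  have hexp : H * Real.exp (-(ηL / 2) * J) =
      H * Real.exp (-(ηL / 2) * J₀) * Real.exp (-(ηL / 2) * n) := by
    rw [hJ, mul_assoc, ← Real.exp_add]
    push_cast
    ring_nf
  have hτ : H * Real.exp (-(ηL / 2) * J) ≤ τ₀ := by
    rw [hexp]
    refine le_trans (mul_le_of_le_one_right (by positivity) ?_) hJ₀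
    rw [Real.exp_le_one_iff]
    nlinarith
  have hτ2 : H * Real.exp (-(ηL / 2) * J) ≤ τ₀ * Real.exp (-γ * n) := by
    rw [hexp]
    have : γ ≤ ηL / 2 := (min_le_right _ _).trans (min_le_left _ _)
    gcongr
  have hρn : ρ ^ n ≤ Real.exp (-γ * n) := by
    rw [← Real.exp_log hρ0, ← Real.exp_nat_mul]
    have h1 : γ ≤ γ₁ := min_le_left _ _
    refine Real.exp_le_exp.2 ?_
    rw [hγ₁] at h1
    nlinarith
  have hfin := happ _ T J (by positivity) hτ hT hTs F u w Λ S n hu hw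
  refine (bestErr_le hd _ ?_).trans (hfin.trans ?_)
  · refine (card_nbhd_le _ _).trans ?_
    rw [hS, pow_add, pow_mul, mul_left_comm ((4 * J₀ + 5) ^ d)]
    refine Nat.mul_le_mul_left _ ?_
    rw [← mul_pow]
    refine Nat.pow_le_pow_left ?_ d
    have h1 : n + 1 ≤ 2 * n := by omega
    have h2 : J ≤ (J₀ + 1) * n := by rw [hJ]; nlinarith
    have h3 : (n + 1) * J ≤ 2 * n * ((J₀ + 1) * n) := Nat.mul_le_mul h1 h2
    nlinarith
  · have e0 := Real.exp_pos (-γ * n)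
    have huU : ‖u‖ ≤ U := huA.trans hU.le
    have e1 : ρ ^ n * ‖u‖ ≤ Real.exp (-γ * n) * U := by gcongr
    have e2 : H * Real.exp (-(ηL / 2) * J) * ‖u‖ ≤ τ₀ * Real.exp (-γ * n) * U := by gcongr
    have e3 : 0 ≤ H * Real.exp (-γ * n) * U := by positivity
    have e4 : ρ ^ n * ‖u‖ + H * Real.exp (-(ηL / 2) * J) * ‖u‖ + ‖u - projH S u‖ ≤
        (1 + τ₀ + H + 1) * U * Real.exp (-γ * n) := by linarith
    calc _ ≤ K * ((1 + τ₀ + H + 1) * U * Real.exp (-γ * n)) := by gcongr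
      _ = _ := by ring

theorem exists_residualSparsity (hd : 1 ≤ d) (D : EllipticData d) {η t ηL : ℝ} (hη : 0 < η)
    (ht : 0 < t) (hηL : 0 < ηL) (hExp : ExpMatrix ηL (stiffness D)) :
    ∃ ηbar tbar : ℝ, ResidualSparsity D η t ηbar tbar := by
  obtain ⟨p, C₀, γ, K, hpt, hp, hC₀, hγ, hK, hdecay⟩ := exists_residual_decay hd D hη ht hηL hExp
  have hd' : (0 : ℝ) < d := by exact_mod_cast hd
  have hp' : (0 : ℝ) < p := by exact_mod_cast hp
  have hC₀' : (0 : ℝ) < C₀ := by exact_mod_cast hC₀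
  have hω := ballVol_pos d
  have hlo := αlo_pos D
  have hhi := αhi_pos D
  -- Chosen so that δ ω_d^{-1/p} M^{1/p} = γ (M/C₀)^{1/p}; the exponent 1/p is tbar/d for tbar =
  -- d/p.
  set δ := γ * (C₀ : ℝ) ^ (-(1 / (p : ℝ))) * ballVol d ^ (1 / (p : ℝ)) with hδ
  have hδ0 : 0 < δ := by positivity
  set L := max K (D.αhi * (D.αhi / D.αlo)) with hL
  have hL0 : 0 < L := hK.trans_le (le_max_left _ _)
  refine ⟨min η δ, d / p, lt_min hη hδ0, min_le_left _ _, by positivity, ?_,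
    L * Real.exp γ, ?_⟩
  · rw [div_le_iff₀ ht] at hpt
    rw [div_le_iff₀ hp']
    linarith
  intro F u hF hu hA Λ w hw
  obtain ⟨F, rfl⟩ := exists_hil hF
  obtain ⟨u, rfl⟩ := exists_hil hu.1
  obtain ⟨w, rfl⟩ := exists_hil (memV_of_memSpan hw.1)
  rw [isSolution_iff] at hu
  rw [coe_residual]
  set r := F - opA D w with hr
  have hratio : ∀ (U : ℝ), expNorm η t (u : Coeff d) < U → ∀ M : ℕ,
      expRatio (min η δ) (d / p) (r : Coeff d) M ≤ L * Real.exp γ * U := by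
    intro U hU M
    have huA := norm_le_expNorm hd ht hA
    have hU0 : 0 < U := ((norm_nonneg u).trans huA).trans_lt hU
    have hrn : ‖r‖ ≤ L * U := by
      have h1 : r = opA D (u - w) := by rw [hr, map_sub, hu]
      rw [h1]
      calc ‖opA D (u - w)‖ ≤ D.αhi * ‖u - w‖ := norm_opA_apply_le D _
        _ ≤ D.αhi * (D.αhi / D.αlo * ‖u‖) := by
          gcongr
          exact norm_sub_galerkin_le_norm D hu hw
        _ = D.αhi * (D.αhi / D.αlo) * ‖u‖ := by ring
        _ ≤ L * U := by
          gcongr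
          · exact le_max_right _ _
          · exact huA.trans hU.le
    have h2 := bestErr_le_of_subsequence hd hp hC₀ hγ hrn (fun n hn =>
      (hdecay F u w Λ U hu hA hU hw n hn).trans (by
        gcongr
        exact le_max_left _ _)) M
    have h3 : (d : ℝ) / p / d = 1 / p := by field_simp
    have h4 : min η δ * ballVol d ^ (-(1 / (p : ℝ))) * (M : ℝ) ^ (1 / (p : ℝ)) ≤
        γ * ((M : ℝ) / C₀) ^ (1 / (p : ℝ)) := by
      calc _ ≤ δ * ballVol d ^ (-(1 / (p : ℝ))) * (M : ℝ) ^ (1 / (p : ℝ)) := by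
            gcongr
            exact min_le_right _ _
        _ = _ := by
            rw [hδ, Real.div_rpow (by positivity) hC₀'.le, Real.rpow_neg hω.le,
              Real.rpow_neg hC₀'.le]
            field_simp
    rw [expRatio, h3]
    calc _ ≤ bestErr (r : Coeff d) M * Real.exp (γ * ((M : ℝ) / C₀) ^ (1 / (p : ℝ))) := by
          have := bestErr_nonneg (r : Coeff d) M
          gcongr
      _ ≤ L * U * Real.exp γ * Real.exp (-γ * ((M : ℝ) / C₀) ^ (1 / (p : ℝ))) *
            Real.exp (γ * ((M : ℝ) / C₀) ^ (1 / (p : ℝ))) := by gcongr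
      _ = L * Real.exp γ * U := by
          rw [mul_assoc (L * U * Real.exp γ), ← Real.exp_add, neg_mul, neg_add_cancel,
            Real.exp_zero]
          ring
  refine ⟨⟨memV_coe r, L * Real.exp γ * (expNorm η t (u : Coeff d) + 1), ?_⟩, ?_⟩
  · rintro _ ⟨M, rfl⟩
    exact hratio _ (lt_add_one _) M
  · refine ciSup_le fun M => ?_
    have hc : 0 < L * Real.exp γ := by positivity
    rw [← div_le_iff₀' hc]
    -- The estimates hold for every U strictly above the norm of u, strictness being needed to
    -- select S; now let U decrease to the norm.
    refine le_of_forall_gt_imp_ge_of_dense fun U hU => ?_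
    rw [div_le_iff₀' hc]
    exact hratio U hU M

/-! ### Cardinality of the active sets and of the predictor sets -/

theorem exists_one_le_mul_rpow {a p : ℝ} (ha : 0 < a) (hp : 0 < p) :
    ∃ c : ℝ, 0 ≤ c ∧ 1 ≤ a * c ^ p := by
  refine ⟨(1 / a) ^ (1 / p), by positivity, ?_⟩
  rw [← Real.rpow_mul (by positivity), one_div_mul_cancel hp.ne', Real.rpow_one,
    mul_one_div_cancel ha.ne']

theorem IsPCRun.isGalerkin {D : EllipticData d} {F : Coeff d} {θ tol : ℝ} {J : ℕ} {N : ℕ∞}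
    {Λ Λhat : ℕ → Finset (Idx d)} {v vhat : ℕ → Coeff d}
    (h : IsPCRun D F θ tol J N Λ Λhat v vhat) {n : ℕ} (hn : (n : ℕ∞) ≤ N) :
    IsGalerkin D F (Λ n) (v n) := by
  cases n with
  | zero =>
    rw [h.init_set, h.init_sol]
    refine ⟨fun _ _ => rfl, fun w hw => ?_⟩
    obtain rfl : w = 0 := funext fun k => hw k (Finset.notMem_empty k)
    have h0 : form D (0 : Coeff d) (0 : Coeff d) = 0 := by
      rw [← lp.coeFn_zero (E := fun _ : Idx d => ℂ) (p := 2), form_eq_inner, inner_zero_left]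
    rw [h0, pairing]
    simp
  | succ n => exact h.corrector_sol n (lt_of_lt_of_le (by exact_mod_cast n.lt_succ_self) hn)

/-- The corrector step from the residual tolerance `ε`: error and cardinality. -/
theorem exists_corrector_bound (hd : 1 ≤ d) (D : EllipticData d) :
    ∃ Q : ℝ, 1 < Q ∧ D.αhi / D.αlo ≤ Q ∧
      ∀ (F u : Hil d) (η t θ tol : ℝ) (J : ℕ) (N : ℕ∞) (Λ Λhat : ℕ → Finset (Idx d))
        (v vhat : ℕ → Coeff d), opA D u = F → 0 < η → 0 < t → MemExpClass η t (u : Coeff d) →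
        0 < θ → θ < 1 → IsEnrichRadius D θ J →
        IsPCRun D (F : Coeff d) θ tol J N Λ Λhat v vhat →
        ∀ (n : ℕ) (w : Hil d), ((n + 1 : ℕ) : ℕ∞) ≤ N → (w : Coeff d) = v (n + 1) → w ≠ u →
        ∀ X : ℝ, 0 ≤ X →
          Real.log (expNorm η t (u : Coeff d) / ‖u - w‖) + Real.log Q ≤ X →
          ((Λ (n + 1)).card : ℝ) ≤
            ballVol d / η ^ ((d : ℝ) / t) * X ^ ((d : ℝ) / t) + 1 := by
  obtain ⟨q, hq0, hq2, hq⟩ := exists_predictor_factor D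
  have hlo := αlo_pos D
  have hhi := αhi_pos D
  have hle : 1 ≤ D.αhi / D.αlo := by
    rw [one_le_div hlo]
    exact αlo_le_αhi D
  have h2q : 0 < 2 - q := by linarith
  -- The new error is at most (α^*/α_*)(q+2)ε and u is approximated up to (2-q)ε; Q is the ratio of
  -- the two, times the 2 from `exists_card_le_norm_sub_le`.
  set Q := D.αhi / D.αlo * (2 * (q + 2) / (2 - q)) with hQ
  have h2 : 2 ≤ 2 * (q + 2) / (2 - q) := by
    rw [le_div_iff₀ h2q]
    linarith
  refine ⟨Q, by nlinarith, by nlinarith, ?_⟩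
  intro F u η t θ tol J N Λ Λhat v vhat hu hη ht hA hθ0 hθ hJ hrun n w hn hw hne X hX0 hX
  have hnN : (n : ℕ∞) < N := lt_of_lt_of_le (by exact_mod_cast n.lt_succ_self) hn
  obtain ⟨S, E, hS, hE, hΛhat⟩ := hrun.predictor n hnN
  have hg := hrun.isGalerkin hnN.le
  obtain ⟨x, hx⟩ := exists_hil (memV_of_memSpan hg.1)
  have hghat := hrun.predictor_sol n hnN
  obtain ⟨y, hy⟩ := exists_hil (memV_of_memSpan hghat.1)
  have hc := hrun.corrector n hnN
  have hg' := hrun.corrector_sol n hnN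
  rw [← hx] at hg hc hS
  rw [← hy] at hghat hc
  rw [← hw] at hg'
  rw [coe_residual] at hc hS
  rw [nrm_coe] at hc
  set ε := 1 / D.αlo * Real.sqrt (1 - θ ^ 2) * ‖F - opA D x‖ with hε
  rw [hΛhat] at hghat hc
  have h3 : ‖u - y‖ ≤ q * ε :=
    hq F u x y θ J (Λ n) S E hu hθ hθ0 hJ hg.1 (hS.norm_sub_le hθ0 hθ) hE hghat
  have h4 := IsCoarse.norm_sub_le D hu hc h3 hg'
  have hpos : 0 < ‖u - w‖ := norm_pos_iff.2 (sub_ne_zero.2 hne.symm)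
  -- If ε vanished, the corrector would be exact, against w ≠ u.
  have hε0 : 0 < ε := by
    by_contra hcon
    have h5 : D.αhi / D.αlo * ((q + 2) * ε) ≤ 0 :=
      mul_nonpos_of_nonneg_of_nonpos (by positivity)
        (mul_nonpos_of_nonneg_of_nonpos (by positivity) (not_lt.1 hcon))
    linarith
  have hU0 : 0 < expNorm η t (u : Coeff d) := by
    have h5 := norm_le_expNorm hd ht hA
    have h6 := norm_sub_galerkin_le_norm D hu hg'
    by_contra hcon
    have h7 : ‖u‖ = 0 := le_antisymm (h5.trans (not_lt.1 hcon)) (norm_nonneg _)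
    rw [h7, mul_zero] at h6
    linarith
  have h5 : Real.log (2 * expNorm η t (u : Coeff d) / ((2 - q) * ε)) ≤ X := by
    refine le_trans ?_ hX
    rw [← Real.log_mul (by positivity) (by positivity)]
    refine Real.log_le_log (by positivity) ?_
    rw [div_mul_eq_mul_div, div_le_div_iff₀ (by positivity) hpos]
    have h6 : Q * ((2 - q) * ε) = 2 * (D.αhi / D.αlo * ((q + 2) * ε)) := by
      rw [hQ]; field_simp
    calc 2 * expNorm η t (u : Coeff d) * ‖u - w‖ ≤
        2 * expNorm η t (u : Coeff d) * (D.αhi / D.αlo * ((q + 2) * ε)) := by gcongr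
      _ = expNorm η t (u : Coeff d) * (Q * ((2 - q) * ε)) := by rw [h6]; ring
      _ = _ := by ring
  obtain ⟨Y, hY1, hY2⟩ := exists_card_le_norm_sub_le hd hη ht hA (ε := (2 - q) * ε)
    (by positivity) hX0 h5
  refine le_trans ?_ hY2
  exact_mod_cast hc.card_le hghat.1 h3 hY1

/-- Quasi-optimality against 0 gives ‖u - w‖ ≤ (α^*/α_*)‖u‖, and ‖u‖ is at most the class norm (the
term N = 0). -/
theorem log_ratio_nonneg (hd : 1 ≤ d) (D : EllipticData d) {F u w : Hil d} {Λ : Finset (Idx d)}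
    {η t Q : ℝ} (hQ : D.αhi / D.αlo ≤ Q) (hu : opA D u = F) (ht : 0 < t)
    (hA : MemExpClass η t (u : Coeff d)) (hw : IsGalerkin D (F : Coeff d) Λ w) (hne : w ≠ u) :
    0 < expNorm η t (u : Coeff d) ∧ 0 < ‖u - w‖ ∧
      0 ≤ Real.log (expNorm η t (u : Coeff d) / ‖u - w‖) + Real.log Q := by
  have hlo := αlo_pos D
  have hhi := αhi_pos D
  have hpos : 0 < ‖u - w‖ := norm_pos_iff.2 (sub_ne_zero.2 hne.symm)
  have h1 := norm_le_expNorm hd ht hA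
  have h2 := norm_sub_galerkin_le_norm D hu hw
  have hQ0 : 0 < Q := lt_of_lt_of_le (by positivity) hQ
  have h3 : ‖u - w‖ ≤ Q * expNorm η t (u : Coeff d) := h2.trans (by gcongr)
  have hU0 : 0 < expNorm η t (u : Coeff d) := by
    by_contra hcon
    have := mul_nonpos_of_nonneg_of_nonpos hQ0.le (not_lt.1 hcon)
    linarith
  refine ⟨hU0, hpos, ?_⟩
  rw [← Real.log_mul (by positivity) (by positivity)]
  refine Real.log_nonneg ?_
  rw [div_mul_eq_mul_div, le_div_iff₀ hpos]
  linarith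

theorem card_active_le (hd : 1 ≤ d) (D : EllipticData d) {η t κ : ℝ} (hη : 0 < η) (ht : 0 < t)
    (htd : t ≤ d) (hκ : 1 < κ) :
    ∃ C : ℝ, 1 < C ∧
      ∀ (F u : Coeff d), MemV F → IsSolution D F u → MemExpClass η t u →
      ∀ (θ tol : ℝ) (J : ℕ), 0 < θ → θ < 1 → IsEnrichRadius D θ J →
      ∀ (N : ℕ∞) (Λ Λhat : ℕ → Finset (Idx d)) (v vhat : ℕ → Coeff d),
      IsPCRun D F θ tol J N Λ Λhat v vhat →
      ∀ n : ℕ, (n : ℕ∞) ≤ N → v n ≠ u →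
        0 ≤ Real.log (expNorm η t u / nrm (u - v n)) + Real.log C ∧
        ((Λ n).card : ℝ) ≤ κ * (ballVol d / η ^ ((d : ℝ) / t)) *
          (Real.log (expNorm η t u / nrm (u - v n)) + Real.log C) ^ ((d : ℝ) / t) := by
  obtain ⟨Q, hQ1, hQ, hcard⟩ := exists_corrector_bound hd D
  have hω := ballVol_pos d
  have hd' : (0 : ℝ) < d := by exact_mod_cast hd
  have hp1 : 1 ≤ (d : ℝ) / t := by rwa [one_le_div ht]
  obtain ⟨c, hc0, hc1⟩ := exists_one_le_mul_rpow (a := ballVol d / η ^ ((d : ℝ) / t))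
    (p := (d : ℝ) / t) (by positivity) (by positivity)
  have hQ0 : 0 < Q := by linarith
  -- Then log C = log Q + c: Q compares the errors, c absorbs the rounding.
  refine ⟨Q * Real.exp c, ?_, ?_⟩
  · have := Real.one_le_exp hc0
    nlinarith
  intro F u hF hu hA θ tol J hθ0 hθ hJ N Λ Λhat v vhat hrun n hn hne
  have hg := hrun.isGalerkin hn
  obtain ⟨F, rfl⟩ := exists_hil hF
  obtain ⟨u, rfl⟩ := exists_hil hu.1
  obtain ⟨w, hw⟩ := exists_hil (memV_of_memSpan hg.1)
  rw [isSolution_iff] at hu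
  rw [← hw] at hne hg ⊢
  have hne' : w ≠ u := fun h => hne (by rw [h])
  obtain ⟨-, -, hX0⟩ := log_ratio_nonneg hd D hQ hu ht hA hg hne'
  rw [nrm_sub_coe, Real.log_mul hQ0.ne' (Real.exp_pos _).ne', Real.log_exp, ← add_assoc]
  set X := Real.log (expNorm η t (u : Coeff d) / ‖u - w‖) + Real.log Q with hX
  refine ⟨by positivity, ?_⟩
  cases n with
  | zero =>
    rw [hrun.init_set, Finset.card_empty, Nat.cast_zero]
    positivity
  | succ n =>
    refine (hcard F u η t θ tol J N Λ Λhat v vhat hu hη ht hA hθ0 hθ hJ hrun n w hn hw hne' X hX0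
      le_rfl).trans ?_
    refine (mul_rpow_add_one_le (by positivity) hp1 hX0 hc0 hc1).trans ?_
    rw [mul_assoc κ]
    exact le_mul_of_one_le_left (by positivity) hκ.le

theorem card_predictor_le (hd : 1 ≤ d) (D : EllipticData d) {η t ηbar tbar : ℝ}
    (ht : 0 < t) (htd : t ≤ d) (hres : ResidualSparsity D η t ηbar tbar) :
    ∃ C : ℝ, 1 < C ∧
      ∀ (F u : Coeff d), MemV F → IsSolution D F u → MemExpClass η t u →
      ∀ (θ tol : ℝ) (J : ℕ), 0 < θ → θ < 1 → IsEnrichRadius D θ J →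
      ∀ (N : ℕ∞) (Λ Λhat : ℕ → Finset (Idx d)) (v vhat : ℕ → Coeff d),
      IsPCRun D F θ tol J N Λ Λhat v vhat →
      ∀ n : ℕ, (n : ℕ∞) < N → v n ≠ u →
        0 ≤ Real.log (expNorm η t u / nrm (u - v n)) +
            |Real.log (Real.sqrt (1 - θ ^ 2))| + Real.log C ∧
        ((Λhat (n + 1)).card : ℝ) ≤ ((Λ n).card : ℝ) +
          (3 ^ d / ballVol d + 1) * (J : ℝ) ^ d * (ballVol d ^ 2 / ηbar ^ ((d : ℝ) / tbar)) *
            (Real.log (expNorm η t u / nrm (u - v n)) +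
              |Real.log (Real.sqrt (1 - θ ^ 2))| + Real.log C) ^ ((d : ℝ) / tbar) := by
  obtain ⟨hη', -, ht', htt, K, hK⟩ := hres
  have hω := ballVol_pos d
  have hlo := αlo_pos D
  have hhi := αhi_pos D
  have hd' : (0 : ℝ) < d := by exact_mod_cast hd
  have hp1 : 1 ≤ (d : ℝ) / tbar := by
    rw [one_le_div ht']
    exact htt.trans htd
  set a := ballVol d / ηbar ^ ((d : ℝ) / tbar) with ha
  have ha0 : 0 < a := by positivity
  obtain ⟨c, hc0, hc1⟩ := exists_one_le_mul_rpow (a := a) (p := (d : ℝ) / tbar) ha0 (by positivity)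
  -- The first term keeps the logarithm nonnegative, the second turns the class norm of r over ‖r‖
  -- into that of u over ‖u - w‖, and 1 makes Q > 1. The sign of K is not known, hence |K|.
  set Q := D.αhi / D.αlo + 2 * |K| / D.αlo + 1 with hQ
  have hQ1 : 1 < Q := by
    have : 0 < D.αhi / D.αlo + 2 * |K| / D.αlo := by positivity
    linarith
  have hQ0 : 0 < Q := by linarith
  have hQhi : D.αhi / D.αlo ≤ Q := by
    have : 0 ≤ 2 * |K| / D.αlo := by positivity
    linarith
  have hQK : 2 * K ≤ Q * D.αlo := by
    rw [← div_le_iff₀ hlo]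
    have h1 : 2 * K / D.αlo ≤ 2 * |K| / D.αlo := by
      gcongr
      exact le_abs_self K
    have h2 : 0 < D.αhi / D.αlo := by positivity
    linarith
  refine ⟨Q * Real.exp c, ?_, ?_⟩
  · have := Real.one_le_exp hc0
    nlinarith
  intro F u hF hu hA θ tol J hθ0 hθ hJ N Λ Λhat v vhat hrun n hn hne
  have hg := hrun.isGalerkin hn.le
  have hres := hK F u hF hu hA (Λ n) (v n) hg
  obtain ⟨S, E, hS, hE, hΛhat⟩ := hrun.predictor n hn
  obtain ⟨F, rfl⟩ := exists_hil hF
  obtain ⟨u, rfl⟩ := exists_hil hu.1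
  obtain ⟨w, hw⟩ := exists_hil (memV_of_memSpan hg.1)
  rw [isSolution_iff] at hu
  rw [← hw] at hne hg hres hS ⊢
  rw [coe_residual] at hres hS
  have hne' : w ≠ u := fun h => hne (by rw [h])
  obtain ⟨hU0, hpos, hX0⟩ := log_ratio_nonneg hd D hQhi hu ht hA hg hne'
  have hs0 : 0 < Real.sqrt (1 - θ ^ 2) := Real.sqrt_pos.2 (by nlinarith)
  rw [nrm_sub_coe, Real.log_mul hQ0.ne' (Real.exp_pos _).ne', Real.log_exp, ← add_assoc]
  set s := Real.sqrt (1 - θ ^ 2) with hs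
  set R := Real.log (expNorm η t (u : Coeff d) / ‖u - w‖) with hR
  have hX0' : 0 ≤ R + |Real.log s| + Real.log Q := by linarith [abs_nonneg (Real.log s)]
  set X := R + |Real.log s| + Real.log Q with hX
  refine ⟨by positivity, ?_⟩
  set r := F - opA D w with hr
  have hrn : D.αlo * ‖u - w‖ ≤ ‖r‖ := by
    have h1 : r = opA D (u - w) := by rw [hr, map_sub, hu]
    rw [h1]
    exact αlo_mul_norm_le D _
  have hr0 : 0 < ‖r‖ := lt_of_lt_of_le (by positivity) hrn
  have hrA := norm_le_expNorm hd ht' hres.1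
  have hrA0 := hr0.trans_le hrA
  have hlog : Real.log (2 * expNorm ηbar tbar (r : Coeff d) / (s * ‖r‖)) ≤ X := by
    have h1 : 2 * expNorm ηbar tbar (r : Coeff d) / (s * ‖r‖) ≤
        expNorm η t (u : Coeff d) / ‖u - w‖ / s * Q := by
      rw [div_div, div_mul_eq_mul_div, div_le_div_iff₀ (by positivity) (by positivity)]
      calc 2 * expNorm ηbar tbar (r : Coeff d) * (‖u - w‖ * s)
          ≤ 2 * (K * expNorm η t (u : Coeff d)) * (‖u - w‖ * s) := by
            gcongr
            exact hres.2
        _ = 2 * K * (expNorm η t (u : Coeff d) * ‖u - w‖ * s) := by ring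
        _ ≤ Q * D.αlo * (expNorm η t (u : Coeff d) * ‖u - w‖ * s) := by gcongr
        _ = expNorm η t (u : Coeff d) * Q * (s * (D.αlo * ‖u - w‖)) := by ring
        _ ≤ expNorm η t (u : Coeff d) * Q * (s * ‖r‖) := by gcongr
    refine (Real.log_le_log (by positivity) h1).trans ?_
    rw [Real.log_mul (by positivity) hQ0.ne', Real.log_div (by positivity) hs0.ne']
    linarith [neg_abs_le (Real.log s)]
  obtain ⟨Y, hY1, hY2⟩ := exists_card_le_norm_sub_le hd hη' ht' hres.1 (ε := s * ‖r‖)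
    (by positivity) hX0' hlog
  have hSY : S.card ≤ Y.card := hS.card_le hθ0 hθ hY1
  have hSc : (S.card : ℝ) ≤ a * (X + c) ^ ((d : ℝ) / tbar) :=
    le_trans (by exact_mod_cast hSY)
      (hY2.trans (mul_rpow_add_one_le ha0.le hp1 hX0' hc0 hc1))
  obtain ⟨_, _, _, _, hJl⟩ := hJ
  have hJ1 : (1 : ℝ) ≤ J := by exact_mod_cast hJl.1.1
  have hEc : (E.card : ℝ) ≤ S.card * (3 * J) ^ d := by
    have h1 : (E.card : ℝ) ≤ S.card * (2 * J + 1) ^ d := by exact_mod_cast hE.card_le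
    refine h1.trans ?_
    gcongr
    linarith
  have hΛc : ((Λhat (n + 1)).card : ℝ) ≤ (Λ n).card + E.card := by
    rw [hΛhat]
    exact_mod_cast Finset.card_union_le _ _
  refine hΛc.trans (add_le_add_right ?_ _)
  refine hEc.trans ?_
  set Z := (X + c) ^ ((d : ℝ) / tbar) with hZ
  have hZ0 : 0 ≤ Z := by positivity
  calc (S.card : ℝ) * (3 * J) ^ d ≤ a * Z * (3 * J) ^ d := by gcongr
    _ = 3 ^ d / ballVol d * (J : ℝ) ^ d * (ballVol d ^ 2 / ηbar ^ ((d : ℝ) / tbar)) * Z := by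
      rw [ha, mul_pow]
      field_simp
    _ ≤ (3 ^ d / ballVol d + 1) * (J : ℝ) ^ d * (ballVol d ^ 2 / ηbar ^ ((d : ℝ) / tbar)) * Z := by
      gcongr
      linarith

end PCAdfour

end

theorem mainTheorem12 (d : ℕ) (hd : 1 ≤ d) :
    (∀ (D : PCAdfour.EllipticData d) (η t κ : ℝ), 0 < η → 0 < t → t ≤ d → 1 < κ →
      ∃ C : ℝ, 1 < C ∧
        ∀ (F u : PCAdfour.Coeff d), PCAdfour.MemV F → PCAdfour.IsSolution D F u →
        PCAdfour.MemExpClass η t u →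
        ∀ (θ tol : ℝ) (J : ℕ), 0 < θ → θ < 1 → 0 ≤ tol → tol < 1 →
        PCAdfour.IsEnrichRadius D θ J →
        ∀ (N : ℕ∞) (Λ Λhat : ℕ → Finset (PCAdfour.Idx d)) (v vhat : ℕ → PCAdfour.Coeff d),
        PCAdfour.IsPCRun D F θ tol J N Λ Λhat v vhat →
        ∀ n : ℕ, (n : ℕ∞) ≤ N → v n ≠ u →
          0 ≤ Real.log (PCAdfour.expNorm η t u / PCAdfour.nrm (u - v n)) + Real.log C ∧
          ((Λ n).card : ℝ) ≤ κ * (PCAdfour.ballVol d / η ^ ((d : ℝ) / t)) *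
            (Real.log (PCAdfour.expNorm η t u / PCAdfour.nrm (u - v n)) + Real.log C)
              ^ ((d : ℝ) / t)) ∧
    (d ≤ 10 → ∃ κ : ℝ, 1 < κ ∧
      ∀ (D : PCAdfour.EllipticData d) (η t ηL ηLbar : ℝ), 0 < η → 0 < t → t ≤ d →
      0 < ηLbar → ηLbar ≤ ηL → PCAdfour.ExpMatrix ηL (PCAdfour.stiffness D) →
      (∃ B : PCAdfour.Idx d → PCAdfour.Idx d → ℂ,
        PCAdfour.IsInverseStiffness D B ∧ PCAdfour.ExpMatrix ηLbar B) →
      η < PCAdfour.ballVol d ^ (t / (d * (1 + 2 * t))) * ηLbar →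
      (∃ ηbar tbar : ℝ, PCAdfour.ResidualSparsity D η t ηbar tbar) ∧
      ∀ ηbar tbar : ℝ, PCAdfour.ResidualSparsity D η t ηbar tbar →
        ∃ C : ℝ, 1 < C ∧
          ∀ (F u : PCAdfour.Coeff d), PCAdfour.MemV F → PCAdfour.IsSolution D F u →
          PCAdfour.MemExpClass η t u →
          ∀ (θ tol : ℝ) (J : ℕ), 0 < θ → θ < 1 → 0 ≤ tol → tol < 1 →
          PCAdfour.IsEnrichRadius D θ J →
          ∀ (N : ℕ∞) (Λ Λhat : ℕ → Finset (PCAdfour.Idx d)) (v vhat : ℕ → PCAdfour.Coeff d),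
          PCAdfour.IsPCRun D F θ tol J N Λ Λhat v vhat →
          ∀ n : ℕ, (n : ℕ∞) < N → v n ≠ u →
            0 ≤ Real.log (PCAdfour.expNorm η t u / PCAdfour.nrm (u - v n)) +
                |Real.log (Real.sqrt (1 - θ ^ 2))| + Real.log C ∧
            ((Λhat (n + 1)).card : ℝ) ≤ ((Λ n).card : ℝ) +
              κ * (J : ℝ) ^ d * (PCAdfour.ballVol d ^ 2 / ηbar ^ ((d : ℝ) / tbar)) *
                (Real.log (PCAdfour.expNorm η t u / PCAdfour.nrm (u - v n)) +
                  |Real.log (Real.sqrt (1 - θ ^ 2))| + Real.log C) ^ ((d : ℝ) / tbar)) := by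
  -- The estimate has 3^d ω_d where the statement has κ ω_d², hence 3^d/ω_d; adding 1 ensures κ > 1.
  refine ⟨fun D η t κ hη ht htd hκ => ?_, fun _ => ⟨3 ^ d / PCAdfour.ballVol d + 1, ?_, ?_⟩⟩
  · obtain ⟨C, hC, h⟩ := PCAdfour.card_active_le hd D hη ht htd hκ
    exact ⟨C, hC, fun F u hF hu hA θ tol J hθ0 hθ _ _ => h F u hF hu hA θ tol J hθ0 hθ⟩
  · have := PCAdfour.ballVol_pos d
    have h : 0 < 3 ^ d / PCAdfour.ballVol d := by positivity
    linarith
  · intro D η t ηL ηLbar hη ht htd hηLbar hηL hExp _ _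
    refine ⟨PCAdfour.exists_residualSparsity hd D hη ht (hηLbar.trans_le hηL) hExp,
      fun ηbar tbar hres => ?_⟩
    obtain ⟨C, hC, h⟩ := PCAdfour.card_predictor_le hd D ht htd hres
    exact ⟨C, hC, fun F u hF hu hA θ tol J hθ0 hθ _ _ => h F u hF hu hA θ tol J hθ0 hθ⟩
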